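/- For an integer $n\ge 2$ let $$d(n)=e^{\gamma}\log\log n-\frac{\sigma(n)}{n},$$ where $\sigma(n)=\sum_{d\mid n}d$ is the sum of the divisors of $n$ and $\gamma$ is Euler's constant. Then, unconditionally, $$\liminf_{n\to\infty}d(n)=0.$$ -/

import Mathlib

/-- The normalized difference `d(n) = e^γ log log n - σ(n)/n` between the two sides of Robin's
inequality, where `γ` is Euler's constant and `σ(n)` is the sum of the divisors of `n`.
It is meaningful for `n ≥ 2`; its values at `n = 0, 1` play no role for limits at infinity. -/
noncomputable def robinDiff (n : ℕ) : ℝ :=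
  Real.exp Real.eulerMascheroniConstant * Real.log (Real.log (n : ℝ)) -
    (ArithmeticFunction.sigma 1 n : ℝ) / (n : ℝ)

open MeasureTheory Set Filter Topology FourierTransform Chebyshev ArithmeticFunction

/-! Write M(q) for the product of (1 - 1/p)⁻¹ over the primes p ≤ q. Everything rests on two
asymptotics with additive error o(1): M(q) = e^γ log q + o(1) (`tendsto_prod_primesLE_sub`) and log
θ(q) = log q + o(1), a consequence of the prime number theorem (`tendsto_theta_div_self`).

Lower bound for d: if n has k distinct prime factors and q is the k-th prime, then σ(n)/n ≤ M(q),
while the primorial of q is at most n, so θ(q) ≤ log n (`exists_prime_sigma_one_div_le`). Hence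
σ(n)/n ≤ e^γ log θ(q) + o(1) ≤ e^γ log log n + o(1). Upper bound along a sequence: take all primes
up to m³ once and raise those up to m to the power m + 1. Then log n ~ m³, and σ(n)/n falls short of
M(m³) by a factor at least 1 - 2/m, which costs only O(log m / m).

The classical Mertens error O(1) in M(q) would be too weak. The sharper form follows from ∑ Λ(n)/(n
log n) = log log x + γ + o(1/log x), which comes by partial summation from ∑ Λ(n)/n = log x - γ +
o(1). The latter has the strength of the prime number theorem. Both it and ψ(x) ~ x are deduced from
the convergence of ∫₁ˣ ψ(t)/t² dt - log x, which is a Tauberian statement: in the variable log x the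
function is Lipschitz, and its Laplace transform is continuous up to Re z = 0 because ζ does not
vanish on Re s = 1 (`tendsto_zero_of_laplace_continuousOn`). The constant γ in the logarithmic sum
is identified by comparison with log ζ(1 + δ) as δ → 0. -/

/-! ### A Tauberian theorem for Lipschitz functions -/

/-- There is a continuous compactly supported function whose Fourier transform has a finite first
absolute moment and total mass one. -/
theorem exists_compactSupport_fourier_kernel :
    ∃ φ : ℝ → ℂ, Continuous φ ∧ HasCompactSupport φ ∧ Integrable (𝓕 φ) ∧
      Integrable (fun s => ‖s‖ * ‖𝓕 φ s‖) ∧ ∫ s, 𝓕 φ s = 1 := by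
  let b : ContDiffBump (0 : ℝ) := ⟨1, 2, one_pos, one_lt_two⟩
  have hsupp : HasCompactSupport (fun x => (b x : ℂ)) :=
    b.hasCompactSupport.comp_left (g := fun r : ℝ => (r : ℂ)) (by simp)
  have hsm : ContDiff ℝ ((⊤ : ℕ∞) : WithTop ℕ∞) (fun x => (b x : ℂ)) :=
    Complex.ofRealCLM.contDiff.comp b.contDiff
  let f : SchwartzMap ℝ ℂ := hsupp.toSchwartzMap hsm
  have hf : (f : ℝ → ℂ) = fun x => (b x : ℂ) := rfl
  refine ⟨f, f.continuous, hsupp, ?_, ?_, ?_⟩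
  · rw [← SchwartzMap.fourier_coe]
    exact (𝓕 f).integrable
  · rw [← SchwartzMap.fourier_coe]
    exact ((𝓕 f).integrable_pow_mul volume 1).congr (.of_forall fun x => by
      simp only [pow_one])
  · have h := congrFun (f.continuous.fourierInv_fourier_eq f.integrable
      (by rw [← SchwartzMap.fourier_coe]; exact (𝓕 f).integrable)) 0
    rw [Real.fourierInv_eq] at h
    simp only [inner_zero_right, AddChar.map_zero_eq_one, one_smul] at h
    rw [h, hf]
    have : b 0 = 1 := b.one_of_mem_closedBall (by simp [b])
    simp [this]

/-- Fubini for the damped convolution of `Φ` with a Fourier transform. -/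
theorem integral_exp_mul_fourier {Φ : ℝ → ℂ} {H : ℂ → ℂ} {φ : ℝ → ℂ} (hφ : Integrable φ)
    {ε : ℝ} (hint : IntegrableOn (fun t : ℝ => Φ t * Complex.exp (-ε * t)) (Ioi 0))
    (hH : ∀ z : ℂ, 0 < z.re → H z = ∫ t in Ioi (0 : ℝ), Φ t * Complex.exp (-z * t))
    (hε : 0 < ε) (T : ℝ) :
    ∫ t in Ioi (0 : ℝ), Φ t * Complex.exp (-ε * t) * 𝓕 φ (t - T) =
      ∫ y : ℝ, φ y * Complex.exp (2 * Real.pi * y * T * Complex.I) *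
        H (ε + 2 * Real.pi * y * Complex.I) := by
  have h1 : ∀ t : ℝ, Φ t * Complex.exp (-ε * t) * 𝓕 φ (t - T) =
      ∫ y : ℝ, (Φ t * Complex.exp (-ε * t) * φ y) *
        Complex.exp (-(2 * Real.pi * y * (t - T) * Complex.I)) := by
    intro t
    rw [Real.fourier_real_eq_integral_exp_smul, ← integral_const_mul]
    refine integral_congr_ae (.of_forall fun y => ?_)
    simp only [smul_eq_mul]
    have : ((-2 * Real.pi * y * (t - T) : ℝ) : ℂ) * Complex.I =
        -(2 * Real.pi * y * (t - T) * Complex.I) := by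
      push_cast
      ring
    rw [this]
    ring
  simp_rw [h1]
  rw [integral_integral_swap]
  · refine integral_congr_ae (.of_forall fun y => ?_)
    simp only
    rw [hH _ (by simpa using hε), ← integral_const_mul]
    refine integral_congr_ae (.of_forall fun t => ?_)
    simp only
    have : Complex.exp (-ε * t) * Complex.exp (-(2 * Real.pi * y * (t - T) * Complex.I)) =
        Complex.exp (2 * Real.pi * y * T * Complex.I) *
          Complex.exp (-(ε + 2 * Real.pi * y * Complex.I) * t) := by
      rw [← Complex.exp_add, ← Complex.exp_add]
      congr 1
      ring
    linear_combination (Φ t * φ y) * this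
  · have := Integrable.mul_prod hint hφ
    refine this.mul_bdd (c := 1) ?_ ?_
    · apply Continuous.aestronglyMeasurable
      fun_prop
    · refine .of_forall fun p => ?_
      simp [Complex.norm_exp]

/-- Continuity up to the boundary lets one remove the damping factor. -/
theorem integral_mul_fourier_eq {Φ : ℝ → ℂ} {H : ℂ → ℂ} {φ : ℝ → ℂ} {K : ℝ}
    (hcont : Continuous φ) (hsupp : HasCompactSupport φ)
    (hi : Integrable (𝓕 φ)) (hi' : Integrable (fun s => ‖s‖ * ‖𝓕 φ s‖))
    (hΦm : AEStronglyMeasurable Φ (volume.restrict (Ioi 0)))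
    (hΦ : ∀ t, 0 ≤ t → ‖Φ t‖ ≤ K * (1 + t))
    (hH : ∀ z : ℂ, 0 < z.re → H z = ∫ t in Ioi (0 : ℝ), Φ t * Complex.exp (-z * t))
    (hHc : ContinuousOn H {z | 0 ≤ z.re}) (T : ℝ) :
    ∫ t in Ioi (0 : ℝ), Φ t * 𝓕 φ (t - T) =
      ∫ y : ℝ, Complex.exp (2 * Real.pi * y * T * Complex.I) *
        (φ y * H (2 * Real.pi * y * Complex.I)) := by
  have hφ : Integrable φ := hcont.integrable_of_hasCompactSupport hsupp
  have hshift : Integrable (fun t => 𝓕 φ (t - T)) := hi.comp_sub_right T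
  have hshift' : Integrable (fun t => ‖t - T‖ * ‖𝓕 φ (t - T)‖) := hi'.comp_sub_right T
  have hdom : Integrable (fun t : ℝ => (|K| * (1 + |T|)) * ‖𝓕 φ (t - T)‖ +
      |K| * (‖t - T‖ * ‖𝓕 φ (t - T)‖)) :=
    (hshift.norm.const_mul _).add (hshift'.const_mul _)
  have hbd : ∀ t : ℝ, 0 < t → ‖Φ t‖ ≤ |K| * (1 + |T|) + |K| * ‖t - T‖ := by
    intro t ht
    have h1 : t ≤ |T| + ‖t - T‖ := by
      rw [Real.norm_eq_abs]
      linarith [le_abs_self T, le_abs_self (t - T)]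
    calc ‖Φ t‖ ≤ K * (1 + t) := hΦ t ht.le
      _ ≤ |K| * (1 + t) := by gcongr; exact le_abs_self K
      _ ≤ |K| * (1 + (|T| + ‖t - T‖)) := by gcongr
      _ = _ := by ring
  have hlim1 : Tendsto (fun ε : ℝ => ∫ t in Ioi (0 : ℝ),
      Φ t * Complex.exp (-ε * t) * 𝓕 φ (t - T)) (𝓝[>] 0)
      (𝓝 (∫ t in Ioi (0 : ℝ), Φ t * 𝓕 φ (t - T))) := by
    refine tendsto_integral_filter_of_dominated_convergence _ ?_ ?_ hdom.integrableOn ?_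
    · refine .of_forall fun ε => ?_
      refine (hΦm.mul ?_).mul hshift.aestronglyMeasurable.restrict
      exact Continuous.aestronglyMeasurable (by fun_prop)
    · filter_upwards [self_mem_nhdsWithin] with ε hε
      filter_upwards [ae_restrict_mem measurableSet_Ioi] with t ht
      have : ‖Complex.exp (-ε * t)‖ ≤ 1 := by
        rw [Complex.norm_exp]
        simp only [Complex.mul_re, Complex.neg_re, Complex.ofReal_re, Complex.neg_im,
          Complex.ofReal_im]
        rw [Real.exp_le_one_iff]
        have := mul_pos (show (0 : ℝ) < ε from hε) (show (0 : ℝ) < t from ht)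
        linarith
      rw [norm_mul, norm_mul]
      calc ‖Φ t‖ * ‖Complex.exp (-ε * t)‖ * ‖𝓕 φ (t - T)‖
          ≤ (|K| * (1 + |T|) + |K| * ‖t - T‖) * 1 * ‖𝓕 φ (t - T)‖ := by
            gcongr
            exact hbd t ht
        _ = _ := by ring
    · refine .of_forall fun t => ?_
      have : Tendsto (fun ε : ℝ => Φ t * Complex.exp (-ε * t) * 𝓕 φ (t - T)) (𝓝 0)
          (𝓝 (Φ t * Complex.exp (-(0 : ℝ) * t) * 𝓕 φ (t - T))) :=
        Continuous.tendsto (by fun_prop) _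
      simpa using this.mono_left nhdsWithin_le_nhds
  have hlim2 : Tendsto (fun ε : ℝ => ∫ y : ℝ, φ y *
      Complex.exp (2 * Real.pi * y * T * Complex.I) * H (ε + 2 * Real.pi * y * Complex.I))
      (𝓝[>] 0) (𝓝 (∫ y : ℝ, Complex.exp (2 * Real.pi * y * T * Complex.I) *
        (φ y * H (2 * Real.pi * y * Complex.I)))) := by
    -- Only heights y in the support of φ matter, so continuity of `H` on a compact rectangle
    -- touching the boundary supplies a majorant uniform in ε.
    have hcomp : IsCompact (Icc (0 : ℝ) 1 ×ˢ tsupport φ) := isCompact_Icc.prod hsupp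
    have hHc' : ContinuousOn (fun p : ℝ × ℝ => H (p.1 + 2 * Real.pi * p.2 * Complex.I))
        (Icc (0 : ℝ) 1 ×ˢ tsupport φ) := by
      refine hHc.comp (Continuous.continuousOn (by fun_prop)) ?_
      rintro ⟨a, b⟩ ⟨ha, -⟩
      simpa using ha.1
    obtain ⟨B, hB⟩ := hcomp.exists_bound_of_continuousOn hHc'
    refine tendsto_integral_filter_of_dominated_convergence (fun y => ‖φ y‖ * B) ?_ ?_
      (hφ.norm.mul_const B) ?_
    · filter_upwards [self_mem_nhdsWithin] with ε hε
      refine ((Continuous.aestronglyMeasurable (by fun_prop)) : AEStronglyMeasurable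
        (fun y : ℝ => φ y * Complex.exp (2 * Real.pi * y * T * Complex.I)) _).mul ?_
      apply Continuous.aestronglyMeasurable
      refine hHc.comp_continuous (by fun_prop) fun y => ?_
      simpa using le_of_lt hε
    · have : ∀ᶠ ε : ℝ in 𝓝[>] 0, ε ∈ Ioc (0 : ℝ) 1 := Ioc_mem_nhdsGT one_pos
      filter_upwards [this] with ε hε
      refine .of_forall fun y => ?_
      by_cases hy : y ∈ tsupport φ
      · rw [norm_mul, norm_mul]
        have h1 : ‖Complex.exp (2 * Real.pi * y * T * Complex.I)‖ = 1 := by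
          simp [Complex.norm_exp]
        rw [h1, mul_one]
        gcongr
        exact hB (ε, y) ⟨⟨hε.1.le, hε.2⟩, hy⟩
      · simp [image_eq_zero_of_notMem_tsupport hy]
    · refine .of_forall fun y => ?_
      have hw : Tendsto (fun ε : ℝ => H (ε + 2 * Real.pi * y * Complex.I)) (𝓝[>] 0)
          (𝓝 (H (2 * Real.pi * y * Complex.I))) := by
        have h0 : ContinuousWithinAt H {z | 0 ≤ z.re} (2 * Real.pi * y * Complex.I) :=
          hHc _ (by simp)
        refine h0.tendsto.comp (tendsto_nhdsWithin_iff.2 ⟨?_, ?_⟩)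
        · have : Tendsto (fun ε : ℝ => (ε + 2 * Real.pi * y * Complex.I : ℂ)) (𝓝 0)
              (𝓝 ((0 : ℝ) + 2 * Real.pi * y * Complex.I)) :=
            Continuous.tendsto (by fun_prop) _
          simpa using this.mono_left nhdsWithin_le_nhds
        · filter_upwards [self_mem_nhdsWithin] with ε hε
          simpa using le_of_lt hε
      have := hw.const_mul (φ y * Complex.exp (2 * Real.pi * y * T * Complex.I))
      convert this using 2
      ring
  refine tendsto_nhds_unique (hlim1.congr' ?_) hlim2
  filter_upwards [self_mem_nhdsWithin] with ε hε
  refine integral_exp_mul_fourier hφ ?_ hH hε T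
  have hε' : (0 : ℝ) < ε := hε
  have hg : IntegrableOn (fun t : ℝ => K * (Real.exp (-ε * t) + t * Real.exp (-ε * t))) (Ioi 0) := by
    refine Integrable.const_mul (Integrable.add ?_ ?_) K
    · exact exp_neg_integrableOn_Ioi 0 hε'
    · have := integrableOn_rpow_mul_exp_neg_mul_rpow (p := 1) (s := 1) (by norm_num)
        (by norm_num) hε'
      refine IntegrableOn.congr_fun this (fun t _ => ?_) measurableSet_Ioi
      simp
  refine hg.mono' (hΦm.mul (Continuous.aestronglyMeasurable (by fun_prop))) ?_
  filter_upwards [ae_restrict_mem measurableSet_Ioi] with t ht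
  rw [norm_mul]
  have : ‖Complex.exp (-ε * t)‖ = Real.exp (-ε * t) := by
    rw [Complex.norm_exp]; simp
  rw [this]
  calc ‖Φ t‖ * Real.exp (-ε * t) ≤ K * (1 + t) * Real.exp (-ε * t) := by
        gcongr; exact hΦ t (le_of_lt ht)
    _ = _ := by ring

/-- A function with small Lipschitz constant whose Laplace transform extends continuously to the
closed half-plane is eventually small. -/
theorem exists_eventually_norm_le_of_laplace_continuousOn :
    ∃ C : ℝ, ∀ (Φ : ℝ → ℂ) (H : ℂ → ℂ) (M : ℝ), 0 < M →
      (∀ s t, 0 ≤ s → 0 ≤ t → ‖Φ s - Φ t‖ ≤ M * |s - t|) →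
      (∀ z : ℂ, 0 < z.re → H z = ∫ t in Ioi (0 : ℝ), Φ t * Complex.exp (-z * t)) →
      ContinuousOn H {z | 0 ≤ z.re} → ∀ᶠ T in atTop, ‖Φ T‖ ≤ C * M := by
  obtain ⟨φ, hcont, hsupp, hi, hi', hone⟩ := exists_compactSupport_fourier_kernel
  set c : ℝ := ∫ s, ‖s‖ * ‖𝓕 φ s‖ with hc
  -- Smoothing at T changes Φ(T) times the kernel mass by at most M c, by the Lipschitz bound. The
  -- smoothed value is eventually at most M by Riemann–Lebesgue, and the mass is eventually at least
  -- 1/2, whence the factor 2.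
  refine ⟨2 * (1 + c), fun Φ H M hM hLip hH hHc => ?_⟩
  have hΦc : ContinuousOn Φ (Ici 0) := by
    have : LipschitzOnWith M.toNNReal Φ (Ici 0) := by
      refine LipschitzOnWith.of_dist_le_mul fun s hs t ht => ?_
      rw [dist_eq_norm, Real.dist_eq, Real.coe_toNNReal _ hM.le]
      exact hLip s t hs ht
    exact this.continuousOn
  have hΦm : AEStronglyMeasurable Φ (volume.restrict (Ioi 0)) :=
    (hΦc.mono Ioi_subset_Ici_self).aestronglyMeasurable measurableSet_Ioi
  have hΦ : ∀ t, 0 ≤ t → ‖Φ t‖ ≤ (‖Φ 0‖ + M) * (1 + t) := by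
    intro t ht
    have h1 := hLip t 0 ht le_rfl
    rw [sub_zero, abs_of_nonneg ht] at h1
    have h2 : ‖Φ t‖ ≤ ‖Φ 0‖ + ‖Φ t - Φ 0‖ := by
      simpa using norm_add_le (Φ 0) (Φ t - Φ 0)
    nlinarith [norm_nonneg (Φ 0)]
  have hJ := integral_mul_fourier_eq hcont hsupp hi hi' hΦm hΦ hH hHc
  have hRL : Tendsto (fun T : ℝ => ∫ y : ℝ, Complex.exp (2 * Real.pi * y * T * Complex.I) *
      (φ y * H (2 * Real.pi * y * Complex.I))) atTop (𝓝 0) := by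
    have h := Real.tendsto_integral_exp_smul_cocompact
      (fun y : ℝ => φ y * H (2 * Real.pi * y * Complex.I))
    have h' := (h.mono_left atBot_le_cocompact).comp tendsto_neg_atTop_atBot
    refine h'.congr fun T => integral_congr_ae (.of_forall fun y => ?_)
    simp only [Circle.smul_def, Real.fourierChar_apply, smul_eq_mul]
    congr 2
    push_cast
    ring
  have hmass : Tendsto (fun T : ℝ => ∫ t in Ioi (0 : ℝ), 𝓕 φ (t - T)) atTop (𝓝 1) := by
    have h1 : ∀ T : ℝ, ∫ t in Ioi (0 : ℝ), 𝓕 φ (t - T) = ∫ t in Ioi (-T), 𝓕 φ t := by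
      intro T
      rw [← integral_indicator measurableSet_Ioi, ← integral_indicator measurableSet_Ioi,
        ← integral_sub_right_eq_self (indicator (Ioi (-T)) (𝓕 φ)) T]
      congr 1
      ext t
      simp only [indicator, mem_Ioi, lt_sub_iff_add_lt, neg_add_cancel]
    simp_rw [h1]
    rw [← hone]
    exact (aecover_Ioi tendsto_neg_atTop_atBot).integral_tendsto_of_countably_generated hi
  have hev : ∀ᶠ T : ℝ in atTop, 1 / 2 ≤ ‖∫ t in Ioi (0 : ℝ), 𝓕 φ (t - T)‖ := by
    have := hmass.norm
    rw [norm_one] at this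
    exact this.eventually (eventually_ge_nhds (by norm_num))
  have hev2 : ∀ᶠ T : ℝ in atTop, ‖∫ y : ℝ, Complex.exp (2 * Real.pi * y * T * Complex.I) *
      (φ y * H (2 * Real.pi * y * Complex.I))‖ ≤ M := by
    have := hRL.norm
    rw [norm_zero] at this
    exact this.eventually (eventually_le_nhds hM)
  filter_upwards [hev, hev2, eventually_ge_atTop 0] with T h1 h2 hT
  have hshift : Integrable (fun t => 𝓕 φ (t - T)) := hi.comp_sub_right T
  have hshift' : Integrable (fun t => ‖t - T‖ * ‖𝓕 φ (t - T)‖) := hi'.comp_sub_right T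
  have hle : ∀ t, t ∈ Ioi (0 : ℝ) → ‖(Φ t - Φ T) * 𝓕 φ (t - T)‖ ≤
      M * (‖t - T‖ * ‖𝓕 φ (t - T)‖) := by
    intro t ht
    rw [norm_mul, ← mul_assoc]
    gcongr
    exact hLip t T (le_of_lt ht) hT
  have hdi : IntegrableOn (fun t => (Φ t - Φ T) * 𝓕 φ (t - T)) (Ioi 0) := by
    refine Integrable.mono' (hshift'.const_mul M).integrableOn
      ((hΦm.sub aestronglyMeasurable_const).mul hshift.aestronglyMeasurable.restrict) ?_
    filter_upwards [ae_restrict_mem measurableSet_Ioi] with t ht using hle t ht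
  have hd : ‖∫ t in Ioi (0 : ℝ), (Φ t - Φ T) * 𝓕 φ (t - T)‖ ≤ M * c := by
    calc ‖∫ t in Ioi (0 : ℝ), (Φ t - Φ T) * 𝓕 φ (t - T)‖
        ≤ ∫ t in Ioi (0 : ℝ), M * (‖t - T‖ * ‖𝓕 φ (t - T)‖) := by
          refine norm_integral_le_of_norm_le (hshift'.const_mul M).integrableOn ?_
          filter_upwards [ae_restrict_mem measurableSet_Ioi] with t ht using hle t ht
      _ ≤ ∫ t, M * (‖t - T‖ * ‖𝓕 φ (t - T)‖) :=
          setIntegral_le_integral (hshift'.const_mul M) (.of_forall fun t => by positivity)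
      _ = M * c := by
          rw [integral_const_mul, hc,
            integral_sub_right_eq_self (fun s => ‖s‖ * ‖𝓕 φ s‖) T]
  have hsplit : Φ T * ∫ t in Ioi (0 : ℝ), 𝓕 φ (t - T) =
      (∫ t in Ioi (0 : ℝ), Φ t * 𝓕 φ (t - T)) -
        ∫ t in Ioi (0 : ℝ), (Φ t - Φ T) * 𝓕 φ (t - T) := by
    rw [← integral_const_mul, eq_sub_iff_add_eq,
      ← integral_add (hshift.integrableOn.const_mul _) hdi]
    refine integral_congr_ae (.of_forall fun t => ?_)
    simp only
    ring
  have h3 : ‖Φ T‖ * ‖∫ t in Ioi (0 : ℝ), 𝓕 φ (t - T)‖ ≤ M + M * c := by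
    rw [← norm_mul, hsplit]
    refine (norm_sub_le _ _).trans (add_le_add ?_ hd)
    rw [hJ T]
    exact h2
  nlinarith [norm_nonneg (Φ T)]

/-- A Tauberian theorem: a Lipschitz function on `[0, ∞)` whose Laplace transform extends
continuously to the closed right half-plane tends to zero at infinity. -/
theorem tendsto_zero_of_laplace_continuousOn {Φ : ℝ → ℂ} {H : ℂ → ℂ} {M : ℝ} (hM : 0 < M)
    (hLip : ∀ s t, 0 ≤ s → 0 ≤ t → ‖Φ s - Φ t‖ ≤ M * |s - t|)
    (hH : ∀ z : ℂ, 0 < z.re → H z = ∫ t in Ioi (0 : ℝ), Φ t * Complex.exp (-z * t))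
    (hHc : ContinuousOn H {z | 0 ≤ z.re}) : Tendsto Φ atTop (𝓝 0) := by
  obtain ⟨C, hC⟩ := exists_eventually_norm_le_of_laplace_continuousOn
  -- Since C is absolute, it may be applied to the dilation Φ(t/a), whose Lipschitz constant is M/a
  -- and whose transform is a H(a z). Letting a grow makes the bound arbitrarily small.
  have hC0 : ∀ a : ℝ, 0 < a → ∀ᶠ T in atTop, ‖Φ (T / a)‖ ≤ C * (M / a) := by
    intro a ha
    refine hC (fun t => Φ (t / a)) (fun z => a * H (a * z)) (M / a) (by positivity) ?_ ?_ ?_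
    · intro s t hs ht
      refine (hLip _ _ (by positivity) (by positivity)).trans (le_of_eq ?_)
      rw [← sub_div, abs_div, abs_of_pos ha]
      ring
    · intro z hz
      have hz' : 0 < (a * z).re := by
        rw [Complex.re_ofReal_mul]; positivity
      rw [hH _ hz']
      have := integral_comp_mul_left_Ioi
        (fun t : ℝ => Φ (t / a) * Complex.exp (-z * t)) 0 ha
      rw [mul_zero] at this
      have h2 : ∀ x : ℝ, Φ (a * x / a) * Complex.exp (-z * (a * x : ℝ)) =
          Φ x * Complex.exp (-(a * z) * x) := by
        intro x
        rw [mul_div_cancel_left₀ _ ha.ne']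
        congr 2
        push_cast
        ring
      simp_rw [h2] at this
      rw [this, Complex.real_smul, ← mul_assoc, Complex.ofReal_inv,
        mul_inv_cancel₀ (by exact_mod_cast ha.ne'), one_mul]
    · refine continuousOn_const.mul (hHc.comp (Continuous.continuousOn (by fun_prop)) ?_)
      intro z hz
      simp only [mem_ofPred_eq, Complex.re_ofReal_mul] at hz ⊢
      exact mul_nonneg ha.le hz
  rw [Metric.tendsto_nhds]
  intro ε hε
  have ha : 0 < (|C| + 1) * M / ε := by positivity
  have := (tendsto_id.const_mul_atTop ha).eventually (hC0 _ ha)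
  filter_upwards [this] with T hT
  simp only [id] at hT
  rw [mul_div_cancel_left₀ _ ha.ne'] at hT
  rw [dist_zero_right]
  refine hT.trans_lt ?_
  have h3 : M / ((|C| + 1) * M / ε) = ε / (|C| + 1) := by field_simp
  rw [h3]
  calc C * (ε / (|C| + 1)) < (|C| + 1) * (ε / (|C| + 1)) := by
        gcongr
        linarith [le_abs_self C]
    _ = ε := by field_simp

/-! ### Partial sums, L-series and Chebyshev estimates -/

/-- Substituting `x = exp t` in an integral over `(1, ∞)`. -/
theorem integral_Ioi_one_eq_integral_comp_exp (g : ℝ → ℂ) :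
    ∫ x in Ioi (1 : ℝ), g x = ∫ t in Ioi (0 : ℝ), (Real.exp t : ℂ) * g (Real.exp t) := by
  have himg : Real.exp '' Ioi 0 = Ioi 1 := by
    ext x
    simp only [mem_image, mem_Ioi]
    constructor
    · rintro ⟨t, ht, rfl⟩
      exact Real.one_lt_exp_iff.2 ht
    · intro hx
      exact ⟨Real.log x, Real.log_pos hx, Real.exp_log (by linarith)⟩
  rw [← himg, integral_image_eq_integral_abs_deriv_smul measurableSet_Ioi
    (fun t _ => (Real.hasDerivAt_exp t).hasDerivWithinAt) Real.exp_injective.injOn]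
  refine integral_congr_ae (.of_forall fun t => ?_)
  simp [abs_of_pos (Real.exp_pos t)]

/-- An L-series with nonnegative coefficients as a Laplace transform of its partial sums. -/
theorem LSeries_eq_mul_integral_exp (f : ℕ → ℝ) {r : ℝ} (hr : 0 ≤ r) {s : ℂ} (hs : r < s.re)
    (hO : (fun n ↦ ∑ k ∈ Finset.Icc 1 n, f k) =O[atTop] fun n ↦ (n : ℝ) ^ r)
    (hf : ∀ n, 0 ≤ f n) :
    LSeries (fun n ↦ f n) s = s * ∫ t in Ioi (0 : ℝ),
      ((∑ k ∈ Finset.Icc 1 ⌊Real.exp t⌋₊, f k : ℝ) : ℂ) * Complex.exp (-s * t) := by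
  rw [LSeries_eq_mul_integral_of_nonneg f hr hs hO hf, integral_Ioi_one_eq_integral_comp_exp]
  congr 1
  refine integral_congr_ae (.of_forall fun t => ?_)
  simp only
  have h : ((Real.exp t : ℝ) : ℂ) ^ (-(s + 1)) = Complex.exp (-(s + 1) * t) := by
    rw [Complex.cpow_def_of_ne_zero (by exact_mod_cast (Real.exp_pos t).ne'),
      ← Complex.ofReal_log (Real.exp_pos t).le, Real.log_exp, mul_comm]
  rw [h]
  have h2 : Complex.exp (-s * t) = Complex.exp t * Complex.exp (-(s + 1) * t) := by
    rw [← Complex.exp_add]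
    congr 1
    ring
  rw [h2]
  push_cast
  ring

theorem sum_Icc_one_eq_sum_Icc_zero {f : ℕ → ℝ} (h0 : f 0 = 0) (n : ℕ) :
    ∑ k ∈ Finset.Icc 1 n, f k = ∑ k ∈ Finset.Icc 0 n, f k := by
  rw [← Finset.add_sum_Ioc_eq_sum_Icc (Nat.zero_le n), h0, zero_add]
  rfl

/-- The sum `∑_{n ≤ x} Λ(n) / n`. -/
noncomputable def mangoldtDivSum (x : ℝ) : ℝ := ∑ k ∈ Finset.Icc 0 ⌊x⌋₊, Λ k / k

theorem measurable_mangoldtDivSum : Measurable mangoldtDivSum :=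
  (measurable_of_countable (fun n : ℕ => ∑ k ∈ Finset.Icc 0 n, Λ k / k)).comp Nat.measurable_floor

theorem psi_div_sq_integrableOn {a b : ℝ} (ha : 0 < a) :
    IntegrableOn (fun t => ψ t / t ^ 2) (Ioc a b) := by
  refine Integrable.mono' (g := fun _ => (Real.log 4 + 4) / a)
    (integrableOn_const (by simp)) ?_ ?_
  · exact (psi_mono.measurable.div (by fun_prop)).aestronglyMeasurable
  · filter_upwards [ae_restrict_mem measurableSet_Ioc] with t ht
    have ht0 : 0 < t := ha.trans ht.1
    rw [Real.norm_of_nonneg (div_nonneg (psi_nonneg t) (by positivity)),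
      div_le_div_iff₀ (by positivity) ha]
    have hlog : 0 ≤ Real.log 4 := Real.log_nonneg (by norm_num)
    have h1 := psi_le_const_mul_self ht0.le
    have h2 : 0 ≤ (Real.log 4 + 4) * t := by positivity
    calc ψ t * a ≤ (Real.log 4 + 4) * t * t :=
          mul_le_mul h1 ht.1.le ha.le h2
      _ = _ := by ring

theorem mangoldtDivSum_eq (x : ℝ) :
    mangoldtDivSum x = ψ x / x + ∫ t in Ioc 1 x, ψ t / t ^ 2 := by
  have h := sum_mul_eq_sub_integral_mul₀ (f := fun t : ℝ => t⁻¹) (fun n => Λ n) (by simp) x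
    (fun t ht => differentiableAt_inv (by linarith [ht.1])) ?_
  · rw [mangoldtDivSum, psi_eq_sum_Icc]
    have h1 : ∑ k ∈ Finset.Icc 0 ⌊x⌋₊, Λ k / (k : ℝ) =
        ∑ k ∈ Finset.Icc 0 ⌊x⌋₊, (k : ℝ)⁻¹ * Λ k :=
      Finset.sum_congr rfl fun k _ => by rw [div_eq_inv_mul]
    rw [h1, h, sub_eq_add_neg, ← integral_neg, div_eq_inv_mul]
    congr 1
    refine integral_congr_ae (.of_forall fun t => ?_)
    simp only [deriv_inv, psi_eq_sum_Icc]
    ring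
  · simp only [deriv_inv']
    refine ContinuousOn.integrableOn_Icc fun t ht => ContinuousAt.continuousWithinAt ?_
    have : t ≠ 0 := by linarith [ht.1]
    fun_prop (disch := positivity)

/-- The integral `∫ ψ(t) / t²` over `[1, x]`, written as a sum. -/
noncomputable def psiIntegral (x : ℝ) : ℝ := mangoldtDivSum x - ψ x / x

/-- The jumps of `mangoldtDivSum` and of ψ(x)/x cancel in the difference. This is why `psiIntegral`,
rather than the discontinuous `mangoldtDivSum`, is fed to the Tauberian theorem. -/
theorem psiIntegral_sub {x y : ℝ} (hx : 1 ≤ x) (hxy : x ≤ y) :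
    psiIntegral y - psiIntegral x = ∫ t in Ioc x y, ψ t / t ^ 2 := by
  rw [psiIntegral, psiIntegral, mangoldtDivSum_eq, mangoldtDivSum_eq,
    ← Ioc_union_Ioc_eq_Ioc hx hxy, setIntegral_union (by simp) measurableSet_Ioc
    (psi_div_sq_integrableOn one_pos) (psi_div_sq_integrableOn (by linarith))]
  ring

theorem integral_Ioc_inv_sq {x y : ℝ} (hx : 0 < x) (hxy : x ≤ y) (c : ℝ) :
    ∫ t in Ioc x y, c / t ^ 2 = c * (1 / x - 1 / y) := by
  rw [← intervalIntegral.integral_of_le hxy]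
  have h : ∀ t ∈ uIcc x y, HasDerivAt (fun t => -c * t⁻¹) (c / t ^ 2) t := by
    intro t ht
    rw [uIcc_of_le hxy] at ht
    have ht0 : t ≠ 0 := by linarith [ht.1]
    refine ((hasDerivAt_inv ht0).const_mul (-c)).congr_deriv ?_
    ring
  rw [intervalIntegral.integral_eq_sub_of_hasDerivAt h]
  · ring
  · refine ContinuousOn.intervalIntegrable fun t ht => ContinuousAt.continuousWithinAt ?_
    rw [uIcc_of_le hxy] at ht
    have ht0 : 0 < t := by linarith [ht.1]
    fun_prop (disch := positivity)

theorem integrableOn_const_div_sq {x y : ℝ} (hx : 0 < x) (c : ℝ) :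
    IntegrableOn (fun t => c / t ^ 2) (Ioc x y) := by
  refine (ContinuousOn.integrableOn_Icc fun t ht => ContinuousAt.continuousWithinAt ?_).mono_set
    Ioc_subset_Icc_self
  have ht0 : 0 < t := by linarith [ht.1]
  fun_prop (disch := positivity)

/-- Monotonicity of ψ brackets the integral between its endpoint values; this and the companion
upper bound later recover ψ(x)/x from increments of `psiIntegral`. -/
theorem le_psiIntegral_sub {x y : ℝ} (hx : 1 ≤ x) (hxy : x ≤ y) :
    ψ x * (1 / x - 1 / y) ≤ psiIntegral y - psiIntegral x := by
  rw [psiIntegral_sub hx hxy, ← integral_Ioc_inv_sq (by linarith) hxy]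
  refine setIntegral_mono_on (integrableOn_const_div_sq (by linarith) _)
    (psi_div_sq_integrableOn (by linarith)) measurableSet_Ioc fun t ht => ?_
  gcongr
  exact ht.1.le

theorem psiIntegral_sub_le {x y : ℝ} (hx : 1 ≤ x) (hxy : x ≤ y) :
    psiIntegral y - psiIntegral x ≤ ψ y * (1 / x - 1 / y) := by
  rw [psiIntegral_sub hx hxy, ← integral_Ioc_inv_sq (by linarith) hxy]
  refine setIntegral_mono_on (psi_div_sq_integrableOn (by linarith))
    (integrableOn_const_div_sq (by linarith) _) measurableSet_Ioc fun t ht => ?_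
  gcongr
  exact ht.2

theorem psiIntegral_one : psiIntegral 1 = 0 := by
  simp [psiIntegral, mangoldtDivSum_eq]

/-- Chebyshev's bound ψ(t) ≤ (log 4 + 4) t under the integral. It is the upper half of the Lipschitz
condition in the variable log x. -/
theorem psiIntegral_sub_le_log {x y : ℝ} (hx : 1 ≤ x) (hxy : x ≤ y) :
    psiIntegral y - psiIntegral x ≤ (Real.log 4 + 4) * (Real.log y - Real.log x) := by
  have hx0 : 0 < x := by linarith
  have h2 : ∫ t in Ioc x y, (Real.log 4 + 4) * t⁻¹ =
      (Real.log 4 + 4) * (Real.log y - Real.log x) := by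
    rw [integral_const_mul, ← intervalIntegral.integral_of_le hxy,
      integral_inv_of_pos hx0 (by linarith), Real.log_div (by linarith) hx0.ne']
  rw [psiIntegral_sub hx hxy, ← h2]
  refine setIntegral_mono_on (psi_div_sq_integrableOn hx0) ?_ measurableSet_Ioc fun t ht => ?_
  · refine (ContinuousOn.integrableOn_Icc fun t ht => ContinuousAt.continuousWithinAt ?_).mono_set
      Ioc_subset_Icc_self
    have ht0 : t ≠ 0 := by linarith [ht.1]
    fun_prop (disch := positivity)
  · have ht0 : 0 < t := by linarith [ht.1]
    have := psi_le_const_mul_self ht0.le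
    calc ψ t / t ^ 2 ≤ (Real.log 4 + 4) * t / t ^ 2 := by gcongr
      _ = _ := by field_simp

theorem psiIntegral_mono {x y : ℝ} (hx : 1 ≤ x) (hxy : x ≤ y) :
    psiIntegral x ≤ psiIntegral y := by
  have h := le_psiIntegral_sub hx hxy
  have h2 : 0 ≤ ψ x * (1 / x - 1 / y) := by
    refine mul_nonneg (psi_nonneg x) (sub_nonneg.2 ?_)
    gcongr
  linarith

theorem mangoldtDivSum_nonneg (x : ℝ) : 0 ≤ mangoldtDivSum x :=
  Finset.sum_nonneg fun _ _ => div_nonneg vonMangoldt_nonneg (Nat.cast_nonneg _)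

theorem mangoldtDivSum_le {x : ℝ} (hx : 1 ≤ x) :
    mangoldtDivSum x ≤ (Real.log 4 + 4) * (1 + Real.log x) := by
  have h1 := psiIntegral_sub_le_log le_rfl hx
  rw [psiIntegral_one, Real.log_one] at h1
  have h2 : ψ x / x ≤ Real.log 4 + 4 := by
    rw [div_le_iff₀ (by linarith)]
    exact psi_le_const_mul_self (by linarith)
  have h3 : psiIntegral x = mangoldtDivSum x - ψ x / x := rfl
  linarith

/-! ### The Laplace transform of `psiIntegral` and its boundary behaviour -/

theorem norm_cexp_neg_mul_ofReal (z : ℂ) (t : ℝ) :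
    ‖Complex.exp (-z * t)‖ = Real.exp (-z.re * t) := by
  rw [Complex.norm_exp]
  simp

theorem integrableOn_laplace_of_le {F : ℝ → ℝ} (hF : Measurable F) {K : ℝ}
    (hK : ∀ t, 0 < t → |F t| ≤ K * (1 + t)) {z : ℂ} (hz : 0 < z.re) :
    IntegrableOn (fun t : ℝ => (F t : ℂ) * Complex.exp (-z * t)) (Ioi 0) := by
  have hg : IntegrableOn
      (fun t : ℝ => K * (Real.exp (-z.re * t) + t * Real.exp (-z.re * t))) (Ioi 0) := by
    refine Integrable.const_mul (Integrable.add ?_ ?_) K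
    · exact exp_neg_integrableOn_Ioi 0 hz
    · have := integrableOn_rpow_mul_exp_neg_mul_rpow (p := 1) (s := 1) (by norm_num)
        (by norm_num) hz
      refine IntegrableOn.congr_fun this (fun t _ => ?_) measurableSet_Ioi
      simp
  refine hg.mono' ?_ ?_
  · refine AEStronglyMeasurable.mul ?_ (Continuous.aestronglyMeasurable (by fun_prop))
    exact (Complex.measurable_ofReal.comp hF).aestronglyMeasurable
  · filter_upwards [ae_restrict_mem measurableSet_Ioi] with t ht
    rw [norm_mul, norm_cexp_neg_mul_ofReal, Complex.norm_real, Real.norm_eq_abs]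
    calc |F t| * Real.exp (-z.re * t) ≤ K * (1 + t) * Real.exp (-z.re * t) := by
          gcongr; exact hK t ht
      _ = _ := by ring

theorem integral_cexp_neg_mul {z : ℂ} (hz : 0 < z.re) :
    ∫ t in Ioi (0 : ℝ), Complex.exp (-z * t) = 1 / z := by
  rw [integral_exp_mul_complex_Ioi (by simpa using hz)]
  simp

theorem integral_mul_cexp_neg_mul {z : ℂ} (hz : 0 < z.re) :
    ∫ t in Ioi (0 : ℝ), (t : ℂ) * Complex.exp (-z * t) = 1 / z ^ 2 := by
  have h0 : z ≠ 0 := by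
    rintro rfl
    simp at hz
  have hd : ∀ t ∈ Ici (0 : ℝ), HasDerivAt
      (fun t : ℝ => -((t : ℂ) / z + 1 / z ^ 2) * Complex.exp (-z * t))
      ((t : ℂ) * Complex.exp (-z * t)) t := by
    intro t _
    have h1 : HasDerivAt (fun t : ℝ => (t : ℂ)) 1 t := Complex.ofRealCLM.hasDerivAt
    have h2 : HasDerivAt (fun t : ℝ => -((t : ℂ) / z + 1 / z ^ 2)) (-(1 / z)) t :=
      ((h1.div_const z).add_const (1 / z ^ 2)).neg
    refine (h2.mul ((h1.const_mul (-z)).cexp)).congr_deriv ?_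
    field_simp
    ring
  have hlim : Tendsto (fun t : ℝ => -((t : ℂ) / z + 1 / z ^ 2) * Complex.exp (-z * t))
      atTop (𝓝 0) := by
    have h1 := tendsto_rpow_mul_exp_neg_mul_atTop_nhds_zero 1 z.re hz
    have h2 := tendsto_rpow_mul_exp_neg_mul_atTop_nhds_zero 0 z.re hz
    have h3 := (h1.mul_const ‖z‖⁻¹).add (h2.mul_const ‖1 / z ^ 2‖)
    rw [zero_mul, zero_mul, add_zero] at h3
    refine squeeze_zero_norm' ?_ h3
    filter_upwards [eventually_ge_atTop 0] with t ht
    rw [norm_mul, norm_neg, norm_cexp_neg_mul_ofReal, Real.rpow_one, Real.rpow_zero, one_mul]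
    have h4 : ‖(t : ℂ) / z + 1 / z ^ 2‖ ≤ t * ‖z‖⁻¹ + ‖1 / z ^ 2‖ := by
      refine (norm_add_le _ _).trans ?_
      rw [norm_div, Complex.norm_of_nonneg ht, div_eq_mul_inv]
    calc ‖(t : ℂ) / z + 1 / z ^ 2‖ * Real.exp (-z.re * t)
        ≤ (t * ‖z‖⁻¹ + ‖1 / z ^ 2‖) * Real.exp (-z.re * t) := by gcongr
      _ = _ := by ring
  have hint : IntegrableOn (fun t : ℝ => (t : ℂ) * Complex.exp (-z * t)) (Ioi 0) := by
    refine integrableOn_laplace_of_le (F := fun t => t) measurable_id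
      (K := 1) (fun t ht => ?_) hz
    rw [abs_of_pos ht]
    linarith
  rw [integral_Ioi_of_hasDerivAt_of_tendsto' hd hint hlim]
  simp

theorem isBigO_psi_natCast :
    (fun n : ℕ => ∑ k ∈ Finset.Icc 1 n, Λ k) =O[atTop] fun n : ℕ => (n : ℝ) ^ (1 : ℝ) := by
  refine Asymptotics.IsBigO.of_bound (Real.log 4 + 4) (.of_forall fun n => ?_)
  rw [sum_Icc_one_eq_sum_Icc_zero (by simp) n]
  have h : ∑ k ∈ Finset.Icc 0 n, Λ k = ψ n := by rw [psi_eq_sum_Icc]; simp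
  rw [h, Real.norm_of_nonneg (psi_nonneg _), Real.rpow_one, Real.norm_natCast]
  exact psi_le_const_mul_self (Nat.cast_nonneg n)

/-- The growth is logarithmic, so every r > 0 is allowed; this makes the integral representation
available on all of Re z > 0. -/
theorem isBigO_mangoldtDivSum_natCast {r : ℝ} (hr : 0 < r) :
    (fun n : ℕ => ∑ k ∈ Finset.Icc 1 n, Λ k / k) =O[atTop] fun n : ℕ => (n : ℝ) ^ r := by
  have h1 : (fun n : ℕ => ∑ k ∈ Finset.Icc 1 n, Λ k / k) =O[atTop]
      fun n : ℕ => 1 + Real.log n := by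
    refine Asymptotics.IsBigO.of_bound (Real.log 4 + 4) ?_
    filter_upwards [eventually_ge_atTop 1] with n hn
    have hn' : (1 : ℝ) ≤ n := by exact_mod_cast hn
    rw [sum_Icc_one_eq_sum_Icc_zero (by simp) n]
    have h : ∑ k ∈ Finset.Icc 0 n, Λ k / k = mangoldtDivSum n := by
      rw [mangoldtDivSum, Nat.floor_natCast]
    have hlog := Real.log_nonneg hn'
    rw [h, Real.norm_of_nonneg (mangoldtDivSum_nonneg _), Real.norm_of_nonneg (by linarith)]
    exact mangoldtDivSum_le hn'
  have h2 : (fun x : ℝ => 1 + Real.log x) =O[atTop] fun x : ℝ => x ^ r :=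
    ((Asymptotics.isLittleO_const_left.2 (Or.inr (tendsto_norm_atTop_atTop.comp
      (tendsto_rpow_atTop hr)))).add (isLittleO_log_rpow_atTop hr)).isBigO
  exact h1.trans (h2.comp_tendsto tendsto_natCast_atTop_atTop)

theorem LSeries_mangoldt_div (z : ℂ) :
    LSeries (fun n => ((Λ n / n : ℝ) : ℂ)) z = LSeries (fun n => (Λ n : ℂ)) (1 + z) := by
  refine tsum_congr fun n => ?_
  rcases eq_or_ne n 0 with rfl | hn
  · simp
  · rw [LSeries.term_of_ne_zero hn, LSeries.term_of_ne_zero hn,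
      Complex.cpow_add _ _ (by exact_mod_cast hn), Complex.cpow_one]
    push_cast
    rw [div_div]

/-- The regular part of `-ζ'/ζ` at `1 + z`. -/
noncomputable def zetaLogDerivAux (z : ℂ) : ℂ :=
  -(deriv riemannZeta₁ (1 + z) / riemannZeta₁ (1 + z))

/-- The analytic input of the prime number theorem: ζ has no zero on Re s ≥ 1. At z = 0 the pole has
already been removed. -/
theorem riemannZeta₁_one_add_ne_zero {z : ℂ} (hz : 0 ≤ z.re) : riemannZeta₁ (1 + z) ≠ 0 := by
  rcases eq_or_ne z 0 with rfl | h0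
  · simp
  · have h1 : (1 + z) ≠ 1 := by simpa using h0
    have h := riemannZeta_ne_zero_of_one_le_re (s := 1 + z) (by simpa using hz)
    rw [riemannZeta_eq_inv_sub_mul h1] at h
    exact right_ne_zero_of_mul h

theorem LSeries_mangoldt_one_add {z : ℂ} (hz : 0 < z.re) :
    LSeries (fun n => (Λ n : ℂ)) (1 + z) = 1 / z + zetaLogDerivAux z := by
  have h0 : z ≠ 0 := by
    rintro rfl
    simp at hz
  have h1 : (1 + z) ≠ 1 := by simpa using h0
  have h2 := riemannZeta₁_one_add_ne_zero hz.le
  rw [LSeries_vonMangoldt_eq_deriv_riemannZeta_div (by simpa using hz),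
    deriv_riemannZeta_eq_neg_inv_sub_sq_mul_add h1, riemannZeta_eq_inv_sub_mul h1,
    zetaLogDerivAux, add_sub_cancel_left]
  field_simp
  ring

/-- The limit of `∑_{n ≤ x} Λ(n)/n - ψ(x)/x - log x`. -/
noncomputable def psiIntegralLimit : ℝ := -1 - Real.eulerMascheroniConstant

/-- The numerator of the Laplace transform in the proof of `tendsto_psiIntegral_sub_log`. -/
noncomputable def psiLaplaceNumerator (z : ℂ) : ℂ :=
  zetaLogDerivAux z - 1 - psiIntegralLimit * (1 + z)

/-- This determines `psiIntegralLimit`: since (s - 1)ζ(s) = 1 + γ(s - 1) + ..., the value is -γ - 1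
- `psiIntegralLimit`. -/
theorem psiLaplaceNumerator_zero : psiLaplaceNumerator 0 = 0 := by
  simp [psiLaplaceNumerator, zetaLogDerivAux, psiIntegralLimit]
  ring

/-- With L = -ζ'/ζ(1 + z), the two sums have transforms L/z and L/(1 + z), differing by L/(z(1 +
z)). Subtracting 1/z² for t and `psiIntegralLimit`/z for the constant cancels the double pole and
leaves `psiLaplaceNumerator`/(z(1 + z)). -/
theorem laplace_psiIntegral {z : ℂ} (hz : 0 < z.re) :
    ∫ t in Ioi (0 : ℝ), ((psiIntegral (Real.exp t) - t - psiIntegralLimit : ℝ) : ℂ) *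
      Complex.exp (-z * t) = dslope psiLaplaceNumerator 0 z / (1 + z) := by
  have h0 : z ≠ 0 := by
    rintro rfl
    simp at hz
  have h1 : 1 + z ≠ 0 := by
    intro h
    have := congrArg Complex.re h
    simp at this
    linarith
  have hlog4 : 0 ≤ Real.log 4 := Real.log_nonneg (by norm_num)
  have hA := LSeries_eq_mul_integral_exp (fun n => Λ n / n) (r := z.re / 2) (s := z)
    (by linarith) (by linarith) (isBigO_mangoldtDivSum_natCast (by linarith))
    (fun n => div_nonneg vonMangoldt_nonneg (Nat.cast_nonneg _))
  have hψ := LSeries_eq_mul_integral_exp (fun n => Λ n) (r := 1) (s := 1 + z)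
    zero_le_one (by simpa using hz) isBigO_psi_natCast (fun n => vonMangoldt_nonneg)
  rw [LSeries_mangoldt_div, LSeries_mangoldt_one_add hz] at hA
  rw [LSeries_mangoldt_one_add hz] at hψ
  have hA' : ∀ t : ℝ, ∑ k ∈ Finset.Icc 1 ⌊Real.exp t⌋₊, Λ k / k = mangoldtDivSum (Real.exp t) :=
    fun t => sum_Icc_one_eq_sum_Icc_zero (by simp) _
  have hψ' : ∀ t : ℝ, ∑ k ∈ Finset.Icc 1 ⌊Real.exp t⌋₊, Λ k = ψ (Real.exp t) := fun t => by
    rw [psi_eq_sum_Icc, sum_Icc_one_eq_sum_Icc_zero (by simp)]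
  simp_rw [hA'] at hA
  simp_rw [hψ'] at hψ
  have hψ2 : ∫ t in Ioi (0 : ℝ), ((ψ (Real.exp t) : ℝ) : ℂ) * Complex.exp (-(1 + z) * t) =
      ∫ t in Ioi (0 : ℝ), ((ψ (Real.exp t) / Real.exp t : ℝ) : ℂ) * Complex.exp (-z * t) := by
    refine integral_congr_ae (.of_forall fun t => ?_)
    simp only
    have : Complex.exp (-(1 + z) * t) = (Complex.exp t)⁻¹ * Complex.exp (-z * t) := by
      rw [← Complex.exp_neg, ← Complex.exp_add]
      congr 1
      ring
    rw [this]
    push_cast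
    ring
  rw [hψ2] at hψ
  have iA : IntegrableOn (fun t : ℝ => ((mangoldtDivSum (Real.exp t) : ℝ) : ℂ) *
      Complex.exp (-z * t)) (Ioi 0) := by
    refine integrableOn_laplace_of_le (F := fun t => mangoldtDivSum (Real.exp t)) (measurable_mangoldtDivSum.comp Real.measurable_exp)
      (K := Real.log 4 + 4) (fun t ht => ?_) hz
    rw [abs_of_nonneg (mangoldtDivSum_nonneg _)]
    simpa using mangoldtDivSum_le (Real.one_le_exp ht.le)
  have iψ : IntegrableOn (fun t : ℝ => ((ψ (Real.exp t) / Real.exp t : ℝ) : ℂ) *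
      Complex.exp (-z * t)) (Ioi 0) := by
    refine integrableOn_laplace_of_le (F := fun t => ψ (Real.exp t) / Real.exp t)
      ((psi_mono.measurable.comp Real.measurable_exp).div Real.measurable_exp)
      (K := Real.log 4 + 4) (fun t ht => ?_) hz
    rw [abs_of_nonneg (div_nonneg (psi_nonneg _) (Real.exp_pos t).le)]
    rw [div_le_iff₀ (Real.exp_pos t)]
    refine (psi_le_const_mul_self (Real.exp_pos t).le).trans ?_
    gcongr
    nlinarith
  have it : IntegrableOn (fun t : ℝ => (t : ℂ) * Complex.exp (-z * t)) (Ioi 0) := by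
    refine integrableOn_laplace_of_le (F := fun t => t) measurable_id
      (K := 1) (fun t ht => ?_) hz
    rw [abs_of_pos ht]
    linarith
  have ic : IntegrableOn (fun t : ℝ => (psiIntegralLimit : ℂ) * Complex.exp (-z * t)) (Ioi 0) := by
    refine integrableOn_laplace_of_le (F := fun t => psiIntegralLimit) measurable_const
      (K := |psiIntegralLimit|) (fun t ht => ?_) hz
    nlinarith [abs_nonneg psiIntegralLimit]
  have hsplit : ∫ t in Ioi (0 : ℝ), ((psiIntegral (Real.exp t) - t - psiIntegralLimit : ℝ) : ℂ) *
      Complex.exp (-z * t) =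
      (∫ t in Ioi (0 : ℝ), ((mangoldtDivSum (Real.exp t) : ℝ) : ℂ) * Complex.exp (-z * t)) -
      (∫ t in Ioi (0 : ℝ), ((ψ (Real.exp t) / Real.exp t : ℝ) : ℂ) * Complex.exp (-z * t)) -
      (∫ t in Ioi (0 : ℝ), (t : ℂ) * Complex.exp (-z * t)) -
      ∫ t in Ioi (0 : ℝ), (psiIntegralLimit : ℂ) * Complex.exp (-z * t) := by
    have iAψ := iA.sub iψ
    have iAψt := iAψ.sub it
    rw [← integral_sub iA iψ, ← integral_sub (by exact iAψ) it, ← integral_sub (by exact iAψt) ic]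
    refine integral_congr_ae (.of_forall fun t => ?_)
    simp only [psiIntegral]
    push_cast
    ring
  have hA2 := eq_div_of_mul_eq h0 ((mul_comm _ _).trans hA.symm)
  have hψ3 := eq_div_of_mul_eq h1 ((mul_comm _ _).trans hψ.symm)
  rw [hsplit, integral_mul_cexp_neg_mul hz, integral_const_mul, integral_cexp_neg_mul hz,
    dslope_of_ne _ h0, slope_def_field, psiLaplaceNumerator_zero, sub_zero, sub_zero,
    hA2, hψ3, psiLaplaceNumerator]
  field_simp
  ring

/-- The numerator is holomorphic on an open set containing the closed half-plane, so `dslope` fills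
in the removable singularity at 0; the other pole, z = -1, lies outside. -/
theorem continuousOn_psiLaplace :
    ContinuousOn (fun z => dslope psiLaplaceNumerator 0 z / (1 + z)) {z : ℂ | 0 ≤ z.re} := by
  set U : Set ℂ := {z | riemannZeta₁ (1 + z) ≠ 0} with hU
  have hUo : IsOpen U := by
    have : Continuous fun z : ℂ => riemannZeta₁ (1 + z) :=
      differentiable_riemannZeta₁.continuous.comp (by fun_prop)
    exact isOpen_ne_fun this continuous_const
  have hsub : {z : ℂ | 0 ≤ z.re} ⊆ U := fun z hz => riemannZeta₁_one_add_ne_zero hz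
  have hd : DifferentiableOn ℂ psiLaplaceNumerator U := by
    intro z hz
    apply DifferentiableAt.differentiableWithinAt
    have h1 : DifferentiableAt ℂ (fun z : ℂ => riemannZeta₁ (1 + z)) z :=
      (differentiable_riemannZeta₁.comp (by fun_prop : Differentiable ℂ fun z : ℂ => 1 + z)) z
    have h2 : DifferentiableAt ℂ (fun z : ℂ => deriv riemannZeta₁ (1 + z)) z :=
      (differentiable_riemannZeta₁.deriv.comp
        (by fun_prop : Differentiable ℂ fun z : ℂ => 1 + z)) z
    exact (((h2.div h1 hz).neg.sub_const 1).sub (by fun_prop))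
  have h0 : U ∈ 𝓝 (0 : ℂ) := hUo.mem_nhds (hsub (by simp))
  have hc := (continuousOn_dslope h0).2 ⟨hd.continuousOn, hd.differentiableAt h0⟩
  refine (hc.mono hsub).div (by fun_prop) fun z hz h => ?_
  have := congrArg Complex.re h
  simp at this
  have hz' : 0 ≤ z.re := hz
  linarith

/-! ### The prime number theorem -/

/-- `∫_1^x ψ(t)/t² dt - log x` converges. -/
theorem tendsto_psiIntegral_sub_log :
    Tendsto (fun x => psiIntegral x - Real.log x) atTop (𝓝 psiIntegralLimit) := by
  have hlog4 : 0 ≤ Real.log 4 := Real.log_nonneg (by norm_num)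
  have hmono : ∀ s t : ℝ, 0 ≤ s → s ≤ t → |psiIntegral (Real.exp s) - s -
      (psiIntegral (Real.exp t) - t)| ≤ (Real.log 4 + 4) * |s - t| := by
    intro s t hs hst
    have h1 := psiIntegral_sub_le_log (Real.one_le_exp hs) (Real.exp_le_exp.2 hst)
    have h2 := psiIntegral_mono (Real.one_le_exp hs) (Real.exp_le_exp.2 hst)
    rw [Real.log_exp, Real.log_exp] at h1
    rw [abs_of_nonpos (sub_nonpos.2 hst), abs_le]
    constructor <;> nlinarith
  have h := tendsto_zero_of_laplace_continuousOn
    (Φ := fun t => ((psiIntegral (Real.exp t) - t - psiIntegralLimit : ℝ) : ℂ))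
    (M := Real.log 4 + 4) (by linarith) ?_ (fun z hz => (laplace_psiIntegral hz).symm)
    continuousOn_psiLaplace
  · have h2 : Tendsto (fun t => psiIntegral (Real.exp t) - t - psiIntegralLimit) atTop (𝓝 0) := by
      exact_mod_cast (Complex.continuous_re.tendsto 0).comp h
    have h3 := (h2.comp Real.tendsto_log_atTop).add_const psiIntegralLimit
    rw [zero_add] at h3
    refine h3.congr' ?_
    filter_upwards [eventually_gt_atTop 0] with x hx
    simp [Real.exp_log hx]
  · intro s t hs ht
    rw [← Complex.ofReal_sub, Complex.norm_real, Real.norm_eq_abs, sub_sub_sub_cancel_right]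
    rcases le_total s t with hst | hst
    · exact hmono s t hs hst
    · rw [abs_sub_comm, abs_sub_comm s t]
      exact hmono t s ht hst

theorem tendsto_psiIntegral_mul_sub {a : ℝ} (ha : 0 < a) :
    Tendsto (fun x => psiIntegral (a * x) - psiIntegral x) atTop (𝓝 (Real.log a)) := by
  have h1 := tendsto_psiIntegral_sub_log.comp (tendsto_id.const_mul_atTop ha)
  have h2 := (h1.sub tendsto_psiIntegral_sub_log).add_const (Real.log a)
  rw [sub_self, zero_add] at h2
  refine h2.congr' ?_
  filter_upwards [eventually_gt_atTop 0] with x hx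
  simp only [Function.comp, id]
  rw [Real.log_mul ha.ne' hx.ne']
  ring

/-- The prime number theorem for the Chebyshev function `ψ`. -/
theorem tendsto_psi_div_self : Tendsto (fun x => ψ x / x) atTop (𝓝 1) := by
  rw [tendsto_order]
  constructor
  · intro b hb
    -- On the window [x/a, x] the increment tends to log a and is at most (ψ(x)/x)(a - 1). As log a
    -- ≥ 1 - 1/a = (a - 1)/a, any b < 1/a is eventually beaten.
    obtain ⟨a, ha1, hab⟩ : ∃ a : ℝ, 1 < a ∧ b < 1 / a := by
      have h : Tendsto (fun a : ℝ => 1 / a) (𝓝[>] 1) (𝓝 (1 / 1)) :=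
        (ContinuousAt.tendsto (by fun_prop (disch := norm_num))).mono_left nhdsWithin_le_nhds
      rw [div_one] at h
      obtain ⟨a, h1, h2⟩ := ((h.eventually (lt_mem_nhds hb)).and self_mem_nhdsWithin).exists
      exact ⟨a, h2, h1⟩
    have ha0 : 0 < a := by linarith
    have hlog : b * (a - 1) < Real.log a := by
      have := Real.one_sub_inv_le_log_of_pos ha0
      calc b * (a - 1) < 1 / a * (a - 1) := by gcongr
        _ = 1 - a⁻¹ := by field_simp
        _ ≤ _ := this
    have h := (tendsto_psiIntegral_mul_sub ha0).comp (tendsto_id.atTop_div_const ha0)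
    filter_upwards [h.eventually (lt_mem_nhds hlog), eventually_ge_atTop a] with x hx hxa
    simp only [Function.comp, id, mul_div_cancel₀ x ha0.ne'] at hx
    have hx0 : 0 < x := by linarith
    have h3 := psiIntegral_sub_le (x := x / a) (y := x) (by rwa [le_div_iff₀ ha0, one_mul])
      (div_le_self hx0.le ha1.le)
    have h4 : ψ x * (1 / (x / a) - 1 / x) = ψ x / x * (a - 1) := by field_simp
    rw [h4] at h3
    exact lt_of_mul_lt_mul_right (hx.trans_le h3) (by linarith)
  · intro b hb
    -- Dually, on [x, a x] the increment is at least (ψ(x)/x)(1 - 1/a), and log a ≤ a - 1 = a(1 -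
    -- 1/a) with a < b.
    obtain ⟨a, ha1, hab⟩ := exists_between hb
    have ha0 : 0 < a := by linarith
    have hlog : Real.log a < b * (1 - 1 / a) := by
      have h1 := Real.log_le_sub_one_of_pos ha0
      calc Real.log a ≤ a - 1 := h1
        _ = a * (1 - 1 / a) := by field_simp
        _ < _ := by
          gcongr
          rw [sub_pos, div_lt_one ha0]
          exact ha1
    have h := tendsto_psiIntegral_mul_sub ha0
    filter_upwards [h.eventually (gt_mem_nhds hlog), eventually_ge_atTop 1] with x hx hx1
    have hx0 : 0 < x := by linarith
    have h3 := le_psiIntegral_sub (x := x) (y := a * x) hx1 (by nlinarith)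
    have h4 : ψ x * (1 / x - 1 / (a * x)) = ψ x / x * (1 - 1 / a) := by field_simp
    rw [h4] at h3
    refine lt_of_mul_lt_mul_right (h3.trans_lt hx) ?_
    rw [sub_nonneg, div_le_one ha0]
    exact ha1.le

/-- The prime number theorem for the Chebyshev function `θ`. -/
theorem tendsto_theta_div_self : Tendsto (fun x => θ x / x) atTop (𝓝 1) := by
  have h : Tendsto (fun x => (ψ x - θ x) / x) atTop (𝓝 0) := by
    obtain ⟨C, hC⟩ := psi_sub_theta_le_mul_sqrt
    have h1 : Tendsto (fun x : ℝ => C * (√x)⁻¹) atTop (𝓝 0) := by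
      simpa using (tendsto_inv_atTop_zero.comp Real.tendsto_sqrt_atTop).const_mul C
    refine squeeze_zero' ?_ ?_ h1
    · filter_upwards [eventually_gt_atTop 0] with x hx
      exact div_nonneg (sub_nonneg.2 (theta_le_psi x)) hx.le
    · filter_upwards [eventually_gt_atTop 0] with x hx
      rw [div_le_iff₀ hx]
      refine (hC x).trans (le_of_eq ?_)
      have hs : √x ≠ 0 := (Real.sqrt_pos.2 hx).ne'
      field_simp
      rw [Real.sq_sqrt hx.le]
  have h2 := tendsto_psi_div_self.sub h
  rw [sub_zero] at h2
  refine h2.congr fun x => ?_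
  ring

theorem tendsto_mangoldtDivSum_sub_log : Tendsto (fun x => mangoldtDivSum x - Real.log x) atTop
    (𝓝 (-Real.eulerMascheroniConstant)) := by
  have h := tendsto_psiIntegral_sub_log.add tendsto_psi_div_self
  have h1 : psiIntegralLimit + 1 = -Real.eulerMascheroniConstant := by
    rw [psiIntegralLimit]; ring
  rw [h1] at h
  refine h.congr fun x => ?_
  rw [psiIntegral]
  ring

/-! ### Partial summation for ∑ Λ(n)/(n log n) -/

/-- The sum `∑_{n ≤ x} Λ(n) / (n log n)`. -/
noncomputable def mangoldtDivLogSum (x : ℝ) : ℝ :=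
  ∑ k ∈ Finset.Icc 0 ⌊x⌋₊, Λ k / (k * Real.log k)

theorem hasDerivAt_inv_log {t : ℝ} (ht : 1 < t) :
    HasDerivAt (fun t => (Real.log t)⁻¹) (-(1 / (t * Real.log t ^ 2))) t := by
  have h0 : t ≠ 0 := by linarith
  have h1 : Real.log t ≠ 0 := (Real.log_pos ht).ne'
  refine ((Real.hasDerivAt_log h0).inv h1).congr_deriv ?_
  field_simp

theorem hasDerivAt_log_log {t : ℝ} (ht : 1 < t) :
    HasDerivAt (fun t => Real.log (Real.log t)) (1 / (t * Real.log t)) t := by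
  have h0 : t ≠ 0 := by linarith
  have h1 : Real.log t ≠ 0 := (Real.log_pos ht).ne'
  refine ((Real.hasDerivAt_log h0).log h1).congr_deriv ?_
  field_simp

theorem integrableOn_Ioi_inv_mul_log_sq {x : ℝ} (hx : 1 < x) :
    IntegrableOn (fun t => 1 / (t * Real.log t ^ 2)) (Ioi x) := by
  have h : Tendsto (fun t => -(Real.log t)⁻¹) atTop (𝓝 (-0)) :=
    (tendsto_inv_atTop_zero.comp Real.tendsto_log_atTop).neg
  refine integrableOn_Ioi_deriv_of_nonneg' (g := fun t => -(Real.log t)⁻¹) (fun t ht => ?_)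
    (fun t ht => ?_) h
  · exact (hasDerivAt_inv_log (hx.trans_le ht)).neg.congr_deriv (neg_neg _)
  · have : 0 < t := by linarith [show x < t from ht]
    positivity

theorem integral_Ioi_inv_mul_log_sq {x : ℝ} (hx : 1 < x) :
    ∫ t in Ioi x, 1 / (t * Real.log t ^ 2) = 1 / Real.log x := by
  have h : Tendsto (fun t => -(Real.log t)⁻¹) atTop (𝓝 (-0)) :=
    (tendsto_inv_atTop_zero.comp Real.tendsto_log_atTop).neg
  rw [integral_Ioi_of_hasDerivAt_of_tendsto' (f := fun t => -(Real.log t)⁻¹) (fun t ht => ?_)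
    (integrableOn_Ioi_inv_mul_log_sq hx) h]
  · simp
  · exact (hasDerivAt_inv_log (hx.trans_le ht)).neg.congr_deriv (neg_neg _)

theorem integral_Ioc_inv_mul_log {x y : ℝ} (hx : 1 < x) (hxy : x ≤ y) :
    IntegrableOn (fun t => 1 / (t * Real.log t)) (Ioc x y) ∧
    ∫ t in Ioc x y, 1 / (t * Real.log t) = Real.log (Real.log y) - Real.log (Real.log x) := by
  have hc : ContinuousOn (fun t => 1 / (t * Real.log t)) (Icc x y) := by
    intro t ht
    have h0 : t ≠ 0 := by linarith [ht.1]
    have h1 : Real.log t ≠ 0 := (Real.log_pos (by linarith [ht.1])).ne'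
    apply ContinuousAt.continuousWithinAt
    fun_prop (disch := positivity)
  refine ⟨hc.integrableOn_Icc.mono_set Ioc_subset_Icc_self, ?_⟩
  rw [← intervalIntegral.integral_of_le hxy]
  refine intervalIntegral.integral_eq_sub_of_hasDerivAt
    (f := fun t => Real.log (Real.log t)) (fun t ht => ?_) ?_
  · rw [uIcc_of_le hxy] at ht
    exact hasDerivAt_log_log (by linarith [ht.1])
  · rw [← uIcc_of_le hxy] at hc
    exact hc.intervalIntegrable

theorem mangoldtDivLogSum_eq (x : ℝ) :
    mangoldtDivLogSum x = mangoldtDivSum x / Real.log x +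
      ∫ t in Ioc 2 x, mangoldtDivSum t * (1 / (t * Real.log t ^ 2)) := by
  have h := sum_mul_eq_sub_integral_mul₁ (f := fun t : ℝ => (Real.log t)⁻¹)
    (fun n => Λ n / n) (by simp) (by simp) x
    (fun t ht => (hasDerivAt_inv_log (by linarith [ht.1])).differentiableAt) ?_
  · have h1 : mangoldtDivLogSum x = ∑ k ∈ Finset.Icc 0 ⌊x⌋₊, (Real.log k)⁻¹ * (Λ k / k) :=
      Finset.sum_congr rfl fun k _ => by
        rw [← div_div, div_eq_mul_inv _ (Real.log k), mul_comm]
    rw [h1, h, sub_eq_add_neg, ← integral_neg, div_eq_inv_mul]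
    congr 1
    refine setIntegral_congr_fun measurableSet_Ioc fun t ht => ?_
    rw [(hasDerivAt_inv_log (by linarith [ht.1])).deriv, mangoldtDivSum]
    ring
  · have hc : ContinuousOn (fun t => -(1 / (t * Real.log t ^ 2))) (Icc 2 x) := by
      intro t ht
      have h0 : t ≠ 0 := by linarith [ht.1]
      have h1 : Real.log t ≠ 0 := (Real.log_pos (by linarith [ht.1])).ne'
      apply ContinuousAt.continuousWithinAt
      fun_prop (disch := positivity)
    refine hc.integrableOn_Icc.congr_fun (fun t ht => ?_) measurableSet_Icc
    exact (hasDerivAt_inv_log (by linarith [ht.1])).deriv.symm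

/-- `∑_{n ≤ x} Λ(n)/(n log n) = log log x + c + o(1 / log x)`. -/
theorem exists_tendsto_mangoldtDivLogSum :
    ∃ c : ℝ, Tendsto (fun x => (mangoldtDivLogSum x - Real.log (Real.log x) - c) * Real.log x)
      atTop (𝓝 0) := by
  set γ := Real.eulerMascheroniConstant with hγ
  set e : ℝ → ℝ := fun t => mangoldtDivSum t - Real.log t + γ with he
  set w : ℝ → ℝ := fun t => 1 / (t * Real.log t ^ 2) with hw
  have hlim : Tendsto e atTop (𝓝 0) := by
    simpa [hγ] using tendsto_mangoldtDivSum_sub_log.add_const γ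
  have hem : Measurable e :=
    (measurable_mangoldtDivSum.sub Real.measurable_log).add_const γ
  have hwnn : ∀ t, 0 < t → 0 ≤ w t := fun t ht => by
    simp only [hw]
    positivity
  have hwi : ∀ x, 1 < x → IntegrableOn w (Ioi x) := fun x hx => integrableOn_Ioi_inv_mul_log_sq hx
  have hewi : IntegrableOn (fun t => e t * w t) (Ioi 2) := by
    obtain ⟨X, hX⟩ := eventually_atTop.1 (hlim.norm.eventually
      (eventually_le_nhds (show ‖(0 : ℝ)‖ < 1 by simp)))
    have hb : ∃ B, ∀ t ∈ Ioi (2 : ℝ), ‖e t‖ ≤ B := by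
      refine ⟨max 1 ((Real.log 4 + 4) * (1 + Real.log X) + Real.log X + |γ|), fun t ht => ?_⟩
      rcases le_total X t with h | h
      · exact (hX t h).trans (le_max_left _ _)
      · refine le_trans ?_ (le_max_right _ _)
        have ht1 : 1 ≤ t := by linarith [show (2 : ℝ) < t from ht]
        have h1 := mangoldtDivSum_le ht1
        have h2 := mangoldtDivSum_nonneg t
        have h3 := Real.log_nonneg ht1
        have h4 := Real.log_le_log (by linarith) h
        have h5 : 0 ≤ Real.log 4 := Real.log_nonneg (by norm_num)
        have h6 : (Real.log 4 + 4) * (1 + Real.log t) ≤ (Real.log 4 + 4) * (1 + Real.log X) := by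
          gcongr
        rw [Real.norm_eq_abs, abs_le]
        constructor <;> linarith [neg_abs_le γ, le_abs_self γ]
    obtain ⟨B, hB⟩ := hb
    refine Integrable.bdd_mul (c := B) (hwi 2 one_lt_two) hem.aestronglyMeasurable ?_
    filter_upwards [ae_restrict_mem measurableSet_Ioi] with t ht using hB t ht
  -- Obtained by inserting `mangoldtDivSum` t = log t - γ + e(t) in `mangoldtDivLogSum_eq`. The
  -- terms ±γ/log x cancel, leaving e(x)/log x and the tail of ∫ e w, both o(1/log x).
  refine ⟨1 - Real.log (Real.log 2) - γ / Real.log 2 + ∫ t in Ioi 2, e t * w t, ?_⟩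
  have key : ∀ x, 2 ≤ x → (mangoldtDivLogSum x - Real.log (Real.log x) -
      (1 - Real.log (Real.log 2) - γ / Real.log 2 + ∫ t in Ioi 2, e t * w t)) * Real.log x =
      e x - (∫ t in Ioi x, e t * w t) * Real.log x := by
    intro x hx
    have hlx : 0 < Real.log x := Real.log_pos (by linarith)
    have hl2 : 0 < Real.log 2 := Real.log_pos one_lt_two
    have i1 := (integral_Ioc_inv_mul_log one_lt_two hx)
    have i2 : IntegrableOn w (Ioc 2 x) := (hwi 2 one_lt_two).mono_set Ioc_subset_Ioi_self
    have i3 : IntegrableOn (fun t => e t * w t) (Ioc 2 x) := hewi.mono_set Ioc_subset_Ioi_self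
    have j2 : ∫ t in Ioc 2 x, w t = 1 / Real.log 2 - 1 / Real.log x := by
      have h1 := integral_Ioi_inv_mul_log_sq one_lt_two
      have h2 := integral_Ioi_inv_mul_log_sq (show 1 < x by linarith)
      rw [← Ioc_union_Ioi_eq_Ioi hx, setIntegral_union (Ioc_disjoint_Ioi le_rfl)
        measurableSet_Ioi i2 (hwi x (by linarith)), h2] at h1
      linarith
    have j3 : ∫ t in Ioi 2, e t * w t =
        (∫ t in Ioc 2 x, e t * w t) + ∫ t in Ioi x, e t * w t := by
      rw [← Ioc_union_Ioi_eq_Ioi hx, setIntegral_union (Ioc_disjoint_Ioi le_rfl)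
        measurableSet_Ioi i3 (hewi.mono_set (Ioi_subset_Ioi hx))]
    have j4 : ∫ t in Ioc 2 x, mangoldtDivSum t * (1 / (t * Real.log t ^ 2)) =
        (∫ t in Ioc 2 x, 1 / (t * Real.log t)) - γ * (∫ t in Ioc 2 x, w t) +
          ∫ t in Ioc 2 x, e t * w t := by
      have i2' := i2.const_mul γ
      have i12 := i1.1.sub i2'
      rw [← integral_const_mul, ← integral_sub i1.1 i2', ← integral_add (by exact i12) i3]
      refine setIntegral_congr_fun measurableSet_Ioc fun t ht => ?_
      have ht0 : 0 < t := by linarith [ht.1]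
      have htl : 0 < Real.log t := Real.log_pos (by linarith [ht.1])
      simp only [he, hw]
      field_simp
      ring
    rw [mangoldtDivLogSum_eq, j4, i1.2, j2, j3]
    have : mangoldtDivSum x = e x + Real.log x - γ := by simp only [he]; ring
    rw [this]
    field_simp
    ring
  have hint : Tendsto (fun x => (∫ t in Ioi x, e t * w t) * Real.log x) atTop (𝓝 0) := by
    rw [Metric.tendsto_nhds]
    intro ε hε
    have h1 := hlim.norm.eventually (eventually_le_nhds (show ‖(0 : ℝ)‖ < ε / 2 by simpa))
    obtain ⟨X, hX⟩ := eventually_atTop.1 h1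
    filter_upwards [eventually_ge_atTop X, eventually_ge_atTop 2] with x hx hx2
    have hlx : 0 < Real.log x := Real.log_pos (by linarith)
    have h2 : ‖∫ t in Ioi x, e t * w t‖ ≤ ε / 2 * (1 / Real.log x) := by
      rw [← integral_Ioi_inv_mul_log_sq (show 1 < x by linarith), ← integral_const_mul]
      refine norm_integral_le_of_norm_le ((hwi x (by linarith)).const_mul _) ?_
      filter_upwards [ae_restrict_mem measurableSet_Ioi] with t ht
      have ht' : x < t := ht
      rw [norm_mul, Real.norm_of_nonneg (hwnn t (by linarith))]
      gcongr
      · exact hwnn t (by linarith)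
      · exact hX t (by linarith)
    rw [dist_zero_right, norm_mul, Real.norm_of_nonneg hlx.le]
    calc _ ≤ ε / 2 * (1 / Real.log x) * Real.log x := by gcongr
      _ = ε / 2 := by field_simp
      _ < ε := by linarith
  have := hlim.sub hint
  rw [sub_zero] at this
  refine this.congr' ?_
  filter_upwards [eventually_ge_atTop 2] with x hx using (key x hx).symm

/-! ### Identification of the constant as γ -/

theorem mellin_log_exp_neg :
    MellinConvergent (fun t : ℝ => Real.log t • (Real.exp (-t) : ℂ)) 1 ∧
    HasDerivAt (mellin fun t : ℝ => (Real.exp (-t) : ℂ))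
      (mellin (fun t : ℝ => Real.log t • (Real.exp (-t) : ℂ)) 1) 1 := by
  refine mellin_hasDerivAt_of_isBigO_rpow (a := 2) (b := 0) ?_ ?_ (by simp) ?_ (by simp)
  · refine (Continuous.continuousOn ?_).locallyIntegrableOn measurableSet_Ioi
    exact Complex.continuous_ofReal.comp (Real.continuous_exp.comp continuous_neg)
  · rw [← Asymptotics.isBigO_norm_left]
    simp_rw [Complex.norm_real, Asymptotics.isBigO_norm_left]
    simpa only [neg_one_mul] using (isLittleO_exp_neg_mul_rpow_atTop zero_lt_one _).isBigO
  · simp_rw [neg_zero, Real.rpow_zero]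
    refine Asymptotics.isBigO_const_of_tendsto (?_ : Tendsto _ _ (𝓝 (1 : ℂ))) one_ne_zero
    rw [(by simp : (1 : ℂ) = Real.exp (-0))]
    exact (Complex.continuous_ofReal.comp
      (Real.continuous_exp.comp continuous_neg)).continuousWithinAt

theorem integrableOn_log_mul_exp_neg :
    IntegrableOn (fun t : ℝ => Real.log t * Real.exp (-t)) (Ioi 0) := by
  have h := mellin_log_exp_neg.1
  rw [MellinConvergent] at h
  have h2 : IntegrableOn (fun t : ℝ => ((Real.log t * Real.exp (-t) : ℝ) : ℂ)) (Ioi 0) := by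
    refine IntegrableOn.congr_fun h (fun t _ => ?_) measurableSet_Ioi
    simp
  exact h2.re

/-- This is Γ'(1) = -γ, with Γ differentiated under its Mellin integral. -/
theorem integral_log_mul_exp_neg :
    ∫ t in Ioi (0 : ℝ), Real.log t * Real.exp (-t) = -Real.eulerMascheroniConstant := by
  have h1 := mellin_log_exp_neg.2
  rw [← Complex.GammaIntegral_eq_mellin] at h1
  have h2 : Complex.Gamma =ᶠ[𝓝 1] Complex.GammaIntegral := by
    filter_upwards [(isOpen_lt continuous_const Complex.continuous_re).mem_nhds
      (show (0 : ℝ) < (1 : ℂ).re by simp)] with z hz using Complex.Gamma_eq_integral hz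
  have h3 := (h1.congr_of_eventuallyEq h2).unique Complex.hasDerivAt_Gamma_one
  rw [mellin] at h3
  have h4 : ∫ t in Ioi (0 : ℝ), ((Real.log t * Real.exp (-t) : ℝ) : ℂ) =
      ((-Real.eulerMascheroniConstant : ℝ) : ℂ) := by
    rw [Complex.ofReal_neg, ← h3]
    refine integral_congr_ae (.of_forall fun t => ?_)
    simp
  rw [integral_complex_ofReal] at h4
  exact_mod_cast h4

theorem integral_exp_neg_Ioi_eq_one : ∫ t in Ioi (0 : ℝ), Real.exp (-t) = 1 := by
  rw [integral_exp_neg_Ioi, neg_zero, Real.exp_zero]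

theorem mangoldtDivLogSum_mono : Monotone mangoldtDivLogSum := by
  intro x y hxy
  refine Finset.sum_le_sum_of_subset_of_nonneg
    (Finset.Icc_subset_Icc le_rfl (Nat.floor_le_floor hxy)) fun k _ _ => ?_
  exact div_nonneg vonMangoldt_nonneg (mul_nonneg (Nat.cast_nonneg _) (Real.log_natCast_nonneg _))

theorem mangoldtDivLogSum_nonneg (x : ℝ) : 0 ≤ mangoldtDivLogSum x :=
  Finset.sum_nonneg fun _ _ =>
    div_nonneg vonMangoldt_nonneg (mul_nonneg (Nat.cast_nonneg _) (Real.log_natCast_nonneg _))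

theorem mangoldtDivLogSum_of_lt_two {x : ℝ} (hx : x < 2) : mangoldtDivLogSum x = 0 := by
  refine Finset.sum_eq_zero fun k hk => ?_
  have h1 : ⌊x⌋₊ < 2 := (Nat.floor_lt' two_ne_zero).2 (by exact_mod_cast hx)
  have h2 := (Finset.mem_Icc.1 hk).2
  have h3 : k < 2 := h2.trans_lt h1
  interval_cases k <;> simp

theorem mangoldtDivLogSum_natCast_le (n : ℕ) :
    mangoldtDivLogSum n ≤ mangoldtDivSum n / Real.log 2 := by
  rw [mangoldtDivLogSum, mangoldtDivSum, Finset.sum_div]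
  refine Finset.sum_le_sum fun k _ => ?_
  have hl2 : 0 < Real.log 2 := Real.log_pos one_lt_two
  rcases lt_or_ge k 2 with hk | hk
  · interval_cases k <;> simp
  · have hk' : (2 : ℝ) ≤ k := by exact_mod_cast hk
    rw [div_div]
    have : Real.log 2 ≤ Real.log k := Real.log_le_log (by norm_num) hk'
    have h0 : 0 ≤ Λ k := vonMangoldt_nonneg
    gcongr

/-- Partial summation of log ζ(1 + δ) = ∑ Λ(n)/(n^(1+δ) log n), rescaled by t = v/δ so that the
weight e^(-v) no longer depends on δ. -/
theorem log_riemannZeta_eq_integral {δ : ℝ} (hδ : 0 < δ) :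
    Real.log (riemannZeta ((1 + δ : ℝ) : ℂ)).re =
      ∫ v in Ioi (0 : ℝ), mangoldtDivLogSum (Real.exp (v / δ)) * Real.exp (-v) := by
  have hO : (fun n : ℕ => ∑ k ∈ Finset.Icc 1 n, Λ k / (k * Real.log k)) =O[atTop]
      fun n : ℕ => (n : ℝ) ^ (δ / 2) := by
    refine Asymptotics.IsBigO.trans ?_ (isBigO_mangoldtDivSum_natCast (r := δ / 2) (by linarith))
    refine Asymptotics.IsBigO.of_bound (Real.log 2)⁻¹ (.of_forall fun n => ?_)
    have h1 : ∑ k ∈ Finset.Icc 1 n, Λ k / (k * Real.log k) = mangoldtDivLogSum n := by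
      rw [sum_Icc_one_eq_sum_Icc_zero (by simp), mangoldtDivLogSum, Nat.floor_natCast]
    have h2 : ∑ k ∈ Finset.Icc 1 n, Λ k / k = mangoldtDivSum n := by
      rw [sum_Icc_one_eq_sum_Icc_zero (by simp), mangoldtDivSum, Nat.floor_natCast]
    rw [h1, h2, Real.norm_of_nonneg (mangoldtDivLogSum_nonneg _),
      Real.norm_of_nonneg (mangoldtDivSum_nonneg _), ← div_eq_inv_mul]
    exact mangoldtDivLogSum_natCast_le n
  have h := LSeries_eq_mul_integral_exp (fun n => Λ n / (n * Real.log n)) (r := δ / 2) (s := δ)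
    (by linarith) (by simp; linarith) hO (fun n => div_nonneg vonMangoldt_nonneg
      (mul_nonneg (Nat.cast_nonneg _) (Real.log_natCast_nonneg _)))
  have hT : ∀ t : ℝ, ∑ k ∈ Finset.Icc 1 ⌊Real.exp t⌋₊, Λ k / (k * Real.log k) =
      mangoldtDivLogSum (Real.exp t) := fun t => sum_Icc_one_eq_sum_Icc_zero (by simp) _
  simp_rw [hT] at h
  have hL : LSeries (fun n => ((Λ n / (n * Real.log n) : ℝ) : ℂ)) δ =
      ((∑' n : ℕ, Λ n / (n ^ (1 + δ) * Real.log n) : ℝ) : ℂ) := by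
    rw [Complex.ofReal_tsum]
    refine tsum_congr fun n => ?_
    rcases eq_or_ne n 0 with rfl | hn
    · simp
    · have hn' : (0 : ℝ) < n := by positivity
      rw [LSeries.term_of_ne_zero hn, ← Complex.ofReal_natCast n,
        ← Complex.ofReal_cpow hn'.le, ← Complex.ofReal_div, Real.rpow_add hn', Real.rpow_one,
        div_div]
      congr 2
      ring
  have hR : ∫ t in Ioi (0 : ℝ), ((mangoldtDivLogSum (Real.exp t) : ℝ) : ℂ) *
      Complex.exp (-δ * t) =
      ((∫ t in Ioi (0 : ℝ), mangoldtDivLogSum (Real.exp t) * Real.exp (-δ * t) : ℝ) : ℂ) := by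
    rw [← integral_complex_ofReal]
    refine integral_congr_ae (.of_forall fun t => ?_)
    simp
  rw [hL, hR, ← Complex.ofReal_mul, Complex.ofReal_inj] at h
  rw [log_riemannZeta_eq (by linarith), h]
  have h2 := integral_comp_mul_left_Ioi
    (fun v => mangoldtDivLogSum (Real.exp (v / δ)) * Real.exp (-v)) 0 hδ
  rw [mul_zero, smul_eq_mul, eq_inv_mul_iff_mul_eq₀ hδ.ne'] at h2
  rw [← h2]
  congr 1
  refine integral_congr_ae (.of_forall fun t => ?_)
  simp only
  rw [mul_div_cancel_left₀ _ hδ.ne', neg_mul]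

theorem mangoldtDivLogSum_bounded {c : ℝ}
    (hc : Tendsto (fun u => mangoldtDivLogSum (Real.exp u) - Real.log u) atTop (𝓝 c)) :
    ∃ B, ∀ u, Real.log 2 ≤ u → |mangoldtDivLogSum (Real.exp u) - Real.log u| ≤ B := by
  obtain ⟨U, hU⟩ := eventually_atTop.1 (hc.abs.eventually
    (eventually_le_nhds (show |c| < |c| + 1 by linarith)))
  refine ⟨max (|c| + 1) (mangoldtDivLogSum (Real.exp U) + |Real.log (Real.log 2)| + |Real.log U|),
    fun u hu => ?_⟩
  rcases le_total U u with h | h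
  · exact (hU u h).trans (le_max_left _ _)
  · refine le_trans ?_ (le_max_right _ _)
    have hl2 : 0 < Real.log 2 := Real.log_pos one_lt_two
    have h1 := mangoldtDivLogSum_nonneg (Real.exp u)
    have h2 := mangoldtDivLogSum_mono (Real.exp_le_exp.2 h)
    have h3 := Real.log_le_log hl2 hu
    have h4 := Real.log_le_log (by linarith) h
    rw [abs_le]
    constructor <;> linarith [neg_abs_le (Real.log (Real.log 2)), le_abs_self (Real.log U),
      neg_abs_le (Real.log U), abs_nonneg (Real.log (Real.log 2)), abs_nonneg (Real.log U)]

/-- As δ → 0, log ζ(1 + δ) + log δ tends to 0 because of the simple pole. By the integral formula it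
also tends to ∫ (c + log v) e^(-v) dv = c - γ. -/
theorem eq_eulerMascheroniConstant_of_tendsto {c : ℝ}
    (hc : Tendsto (fun u => mangoldtDivLogSum (Real.exp u) - Real.log u) atTop (𝓝 c)) :
    c = Real.eulerMascheroniConstant := by
  obtain ⟨B, hB⟩ := mangoldtDivLogSum_bounded hc
  have hl2 : 0 < Real.log 2 := Real.log_pos one_lt_two
  have hexp : IntegrableOn (fun v : ℝ => Real.exp (-v)) (Ioi 0) := integrableOn_exp_neg_Ioi 0
  have hzeta : Tendsto (fun δ : ℝ => Real.log (riemannZeta ((1 + δ : ℝ) : ℂ)).re + Real.log δ)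
      (𝓝[>] 0) (𝓝 0) := by
    have h1 := (Asymptotics.isLittleO_one_iff ℝ).1 log_riemannZeta_add_log_sub_isLittleO_ofReal
    have h2 : Tendsto (fun δ : ℝ => 1 + δ) (𝓝[>] 0) (𝓝[>] 1) := by
      refine tendsto_nhdsWithin_iff.2 ⟨?_, ?_⟩
      · have : Tendsto (fun δ : ℝ => 1 + δ) (𝓝 0) (𝓝 (1 + 0)) :=
          Continuous.tendsto (by fun_prop) _
        rw [add_zero] at this
        exact this.mono_left nhdsWithin_le_nhds
      · filter_upwards [self_mem_nhdsWithin] with δ hδ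
        simpa using hδ
    refine (h1.comp h2).congr fun δ => ?_
    simp
  set D : ℝ → ℝ := fun v => (B + |Real.log (Real.log 2)|) * Real.exp (-v) +
    |Real.log v * Real.exp (-v)| with hD
  have hDi : IntegrableOn D (Ioi 0) := (hexp.const_mul _).add integrableOn_log_mul_exp_neg.abs
  have hDb : ∀ δ : ℝ, 0 < δ → δ < 1 → ∀ v : ℝ, 0 < v →
      ‖(mangoldtDivLogSum (Real.exp (v / δ)) + Real.log δ) * Real.exp (-v)‖ ≤ D v := by
    intro δ h0 h1 v hv
    have hB0 : 0 ≤ B := (abs_nonneg _).trans (hB (Real.log 2) le_rfl)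
    rw [norm_mul, Real.norm_of_nonneg (Real.exp_pos (-v)).le, hD]
    simp only
    rw [abs_mul, abs_of_pos (Real.exp_pos (-v)), ← add_mul]
    gcongr
    rw [Real.norm_eq_abs]
    rcases le_or_gt (Real.log 2) (v / δ) with h | h
    · have h2 := hB _ h
      rw [Real.log_div hv.ne' h0.ne'] at h2
      have h3 := abs_add_le (mangoldtDivLogSum (Real.exp (v / δ)) - (Real.log v - Real.log δ))
        (Real.log v)
      rw [show mangoldtDivLogSum (Real.exp (v / δ)) - (Real.log v - Real.log δ) + Real.log v =
        mangoldtDivLogSum (Real.exp (v / δ)) + Real.log δ by ring] at h3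
      linarith [abs_nonneg (Real.log (Real.log 2))]
    -- Here the sum is empty of prime powers, and v/δ < log 2 gives -log δ ≤ log log 2 - log v, so
    -- `D` still dominates independently of δ.
    · have h2 : Real.exp (v / δ) < 2 := by
        rwa [← Real.lt_log_iff_exp_lt (by norm_num)]
      rw [mangoldtDivLogSum_of_lt_two h2, zero_add,
        abs_of_nonpos (Real.log_nonpos h0.le h1.le)]
      have h3 := Real.log_le_log (div_pos hv h0) h.le
      rw [Real.log_div hv.ne' h0.ne'] at h3
      linarith [neg_abs_le (Real.log v), le_abs_self (Real.log (Real.log 2))]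
  have hlim : Tendsto (fun δ : ℝ => ∫ v in Ioi (0 : ℝ),
      (mangoldtDivLogSum (Real.exp (v / δ)) + Real.log δ) * Real.exp (-v)) (𝓝[>] 0)
      (𝓝 (∫ v in Ioi (0 : ℝ), (c + Real.log v) * Real.exp (-v))) := by
    refine tendsto_integral_filter_of_dominated_convergence D ?_ ?_ hDi ?_
    · refine .of_forall fun δ => ?_
      have : Measurable fun v => mangoldtDivLogSum (Real.exp (v / δ)) :=
        mangoldtDivLogSum_mono.measurable.comp (Real.measurable_exp.comp (measurable_id.div_const δ))
      exact ((this.add_const _).mul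
        (Real.measurable_exp.comp measurable_neg)).aestronglyMeasurable
    · filter_upwards [Ioo_mem_nhdsGT one_pos] with δ hδ
      filter_upwards [ae_restrict_mem measurableSet_Ioi] with v hv
      exact hDb δ hδ.1 hδ.2 v hv
    · filter_upwards [ae_restrict_mem measurableSet_Ioi] with v hv
      have hv' : 0 < v := hv
      have h1 : Tendsto (fun δ : ℝ => v / δ) (𝓝[>] 0) atTop := by
        simp_rw [div_eq_mul_inv]
        exact tendsto_inv_nhdsGT_zero.const_mul_atTop hv'
      have h2 := ((hc.comp h1).add_const (Real.log v)).mul_const (Real.exp (-v))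
      refine h2.congr' ?_
      filter_upwards [self_mem_nhdsWithin] with δ hδ
      have hδ' : (0 : ℝ) < δ := hδ
      simp only [Function.comp]
      rw [Real.log_div hv'.ne' hδ'.ne']
      ring
  have heq : ∫ v in Ioi (0 : ℝ), (c + Real.log v) * Real.exp (-v) =
      c - Real.eulerMascheroniConstant := by
    simp_rw [add_mul]
    rw [integral_add (hexp.const_mul c) integrableOn_log_mul_exp_neg, integral_const_mul,
      integral_exp_neg_Ioi_eq_one, integral_log_mul_exp_neg]
    ring
  rw [heq] at hlim
  have h0 : c - Real.eulerMascheroniConstant = 0 := by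
    refine tendsto_nhds_unique hlim (hzeta.congr' ?_)
    filter_upwards [Ioo_mem_nhdsGT one_pos] with δ hδ
    have hi : IntegrableOn (fun v =>
        (mangoldtDivLogSum (Real.exp (v / δ)) + Real.log δ) * Real.exp (-v)) (Ioi 0) := by
      refine hDi.mono' ?_ ?_
      · have : Measurable fun v => mangoldtDivLogSum (Real.exp (v / δ)) :=
          mangoldtDivLogSum_mono.measurable.comp
            (Real.measurable_exp.comp (measurable_id.div_const δ))
        exact ((this.add_const _).mul
          (Real.measurable_exp.comp measurable_neg)).aestronglyMeasurable
      · filter_upwards [ae_restrict_mem measurableSet_Ioi] with v hv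
        exact hDb δ hδ.1 hδ.2 v hv
    rw [log_riemannZeta_eq_integral hδ.1, eq_comm]
    have h1 := integral_sub hi (hexp.const_mul (Real.log δ))
    rw [integral_const_mul, integral_exp_neg_Ioi_eq_one, mul_one, eq_sub_iff_add_eq] at h1
    rw [← h1]
    congr 1
    refine integral_congr_ae (.of_forall fun v => ?_)
    simp only
    ring
  linarith

/-- `∑_{n ≤ x} Λ(n)/(n log n) = log log x + γ + o(1 / log x)`. -/
theorem tendsto_mangoldtDivLogSum :
    Tendsto (fun x => (mangoldtDivLogSum x - Real.log (Real.log x) -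
      Real.eulerMascheroniConstant) * Real.log x) atTop (𝓝 0) := by
  obtain ⟨c, hc⟩ := exists_tendsto_mangoldtDivLogSum
  have h1 := hc.mul (tendsto_inv_atTop_zero.comp Real.tendsto_log_atTop)
  rw [mul_zero] at h1
  have h2 := (h1.add_const c).comp Real.tendsto_exp_atTop
  rw [zero_add] at h2
  have h3 : Tendsto (fun u => mangoldtDivLogSum (Real.exp u) - Real.log u) atTop (𝓝 c) := by
    refine h2.congr' ?_
    filter_upwards [eventually_gt_atTop 0] with u hu
    simp only [Function.comp, Real.log_exp]
    field_simp
    ring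
  rwa [eq_eulerMascheroniConstant_of_tendsto h3] at hc

/-! ### Mertens' product with error o(1) -/

theorem sum_isPrimePow_eq_sum_primesLE (f : ℕ → ℝ) (n : ℕ) :
    ∑ m ∈ Finset.Ioc 0 n with IsPrimePow m, f m =
      ∑ p ∈ Nat.primesLE n, ∑ k ∈ Finset.Icc 1 (Nat.log p n), f (p ^ k) := by
  rw [Finset.sum_sigma']
  symm
  refine Finset.sum_bij (fun x _ => x.1 ^ x.2) ?_ ?_ ?_ ?_
  · rintro ⟨p, k⟩ hx
    simp only [Finset.mem_sigma, Nat.mem_primesLE, Finset.mem_Icc] at hx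
    obtain ⟨⟨hpn, hp⟩, hk1, hk⟩ := hx
    have hn : n ≠ 0 := by
      have := hp.pos
      omega
    simp only [Finset.mem_filter, Finset.mem_Ioc]
    exact ⟨⟨pow_pos hp.pos k, Nat.pow_le_of_le_log hn hk⟩, hp.isPrimePow.pow (by omega)⟩
  · rintro ⟨p, k⟩ hx ⟨q, l⟩ hy h
    simp only [Finset.mem_sigma, Nat.mem_primesLE, Finset.mem_Icc] at hx hy
    obtain ⟨⟨-, hp⟩, hk, -⟩ := hx
    obtain ⟨⟨-, hq⟩, hl, -⟩ := hy
    obtain ⟨rfl, rfl⟩ : p = q ∧ k = l := hp.pow_inj' hq (by omega) (by omega) h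
    rfl
  · intro m hm
    simp only [Finset.mem_filter, Finset.mem_Ioc] at hm
    obtain ⟨⟨hm0, hmn⟩, hpp⟩ := hm
    obtain ⟨p, k, hp, hk, rfl⟩ := (isPrimePow_nat_iff m).1 hpp
    refine ⟨⟨p, k⟩, ?_, rfl⟩
    simp only [Finset.mem_sigma, Nat.mem_primesLE, Finset.mem_Icc]
    exact ⟨⟨(Nat.le_self_pow hk.ne' p).trans hmn, hp⟩, hk,
      Nat.le_log_of_pow_le hp.one_lt hmn⟩
  · intro x _
    rfl

/-- The logarithm of the Mertens product `∏_{p ≤ n} (1 - 1/p)⁻¹`. -/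
noncomputable def mertensLog (n : ℕ) : ℝ := ∑ p ∈ Nat.primesLE n, -Real.log (1 - (p : ℝ)⁻¹)

/-- The prime power p^k contributes p^(-k)/k, so the sum collects truncations of the series for
-log(1 - 1/p). -/
theorem mangoldtDivLogSum_natCast (n : ℕ) :
    mangoldtDivLogSum n = ∑ p ∈ Nat.primesLE n,
      ∑ i ∈ Finset.range (Nat.log p n), (p : ℝ)⁻¹ ^ (i + 1) / (i + 1) := by
  have h1 : mangoldtDivLogSum n =
      ∑ m ∈ Finset.Ioc 0 n with IsPrimePow m, Λ m / (m * Real.log m) := by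
    rw [mangoldtDivLogSum, Nat.floor_natCast, Finset.sum_filter,
      ← Finset.add_sum_Ioc_eq_sum_Icc (Nat.zero_le n)]
    rw [ArithmeticFunction.map_zero, zero_div, zero_add]
    refine Finset.sum_congr rfl fun m _ => ?_
    split_ifs with h
    · rfl
    · rw [vonMangoldt_eq_zero_iff.2 h, zero_div]
  rw [h1, sum_isPrimePow_eq_sum_primesLE]
  refine Finset.sum_congr rfl fun p hp => ?_
  have hp' := Nat.prime_of_mem_primesLE hp
  have hlog : Real.log p ≠ 0 := (Real.log_pos (by exact_mod_cast hp'.one_lt)).ne'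
  have hp0 : (p : ℝ) ≠ 0 := by exact_mod_cast hp'.ne_zero
  have hr : ∑ i ∈ Finset.range (Nat.log p n), (p : ℝ)⁻¹ ^ (i + 1) / (i + 1) =
      ∑ k ∈ Finset.Icc 1 (Nat.log p n), (p : ℝ)⁻¹ ^ k / k := by
    refine Finset.sum_nbij' (· + 1) (· - 1) ?_ ?_ ?_ ?_ ?_ <;> simp <;> omega
  rw [hr]
  refine Finset.sum_congr rfl fun k hk => ?_
  have hk0 : k ≠ 0 := by
    have := (Finset.mem_Icc.1 hk).1
    omega
  have hk' : (k : ℝ) ≠ 0 := by exact_mod_cast hk0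
  rw [vonMangoldt_apply_pow hk0, vonMangoldt_apply_prime hp']
  push_cast
  rw [Real.log_pow, inv_pow]
  field_simp

theorem abs_mertensLog_sub_le {n : ℕ} (hn : 1 ≤ n) :
    |mertensLog n - mangoldtDivLogSum n| ≤ 2 * (1 + Real.log n) / √n := by
  rw [mangoldtDivLogSum_natCast, mertensLog, ← Finset.sum_sub_distrib]
  have hn0 : (0 : ℝ) < n := by exact_mod_cast hn
  have hterm : ∀ p ∈ Nat.primesLE n, |-Real.log (1 - (p : ℝ)⁻¹) -
      ∑ i ∈ Finset.range (Nat.log p n), (p : ℝ)⁻¹ ^ (i + 1) / (i + 1)| ≤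
      2 / √n * (p : ℝ)⁻¹ := by
    intro p hp
    have hp' := Nat.prime_of_mem_primesLE hp
    have hpn := Nat.le_of_mem_primesLE hp
    have hp2 : (2 : ℝ) ≤ p := by exact_mod_cast hp'.two_le
    have hp0 : (0 : ℝ) < p := by linarith
    have hinv : (p : ℝ)⁻¹ ≤ 1 / 2 := by
      rw [inv_eq_one_div]
      gcongr
    have hinv0 : 0 < (p : ℝ)⁻¹ := by positivity
    set K := Nat.log p n with hK
    have hK1 : 1 ≤ K := Nat.le_log_of_pow_le hp'.one_lt (by simpa using hpn)
    have h := Real.abs_log_sub_add_sum_range_le (x := (p : ℝ)⁻¹)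
      (by rw [abs_of_pos hinv0]; linarith) K
    rw [abs_of_pos hinv0] at h
    rw [← abs_neg, show -(-Real.log (1 - (p : ℝ)⁻¹) - ∑ i ∈ Finset.range K,
      (p : ℝ)⁻¹ ^ (i + 1) / (i + 1)) = (∑ i ∈ Finset.range K,
      (p : ℝ)⁻¹ ^ (i + 1) / (i + 1)) + Real.log (1 - (p : ℝ)⁻¹) by ring]
    have hnlt : (n : ℝ) ≤ (p : ℝ) ^ (K + 1) := by
      exact_mod_cast (Nat.lt_pow_succ_log_self hp'.one_lt n).le
    -- p^(K+1) is at least n by the choice of K and at least p² since K ≥ 1, hence at least their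
    -- geometric mean. The remaining factor 1/p makes the sum over p only logarithmic.
    have hsq : √n * p ≤ (p : ℝ) ^ (K + 1) := by
      have h1 : (p : ℝ) ^ 2 ≤ (p : ℝ) ^ (K + 1) :=
        pow_le_pow_right₀ (by linarith) (by omega)
      have h2 : √n * √((p : ℝ) ^ 2) ≤ √((p : ℝ) ^ (K + 1)) * √((p : ℝ) ^ (K + 1)) := by
        gcongr
      rwa [Real.sqrt_sq hp0.le, Real.mul_self_sqrt (by positivity)] at h2
    have hs : 0 < √(n : ℝ) := Real.sqrt_pos.2 hn0
    calc _ ≤ (p : ℝ)⁻¹ ^ (K + 1) / (1 - (p : ℝ)⁻¹) := h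
      _ ≤ (p : ℝ)⁻¹ ^ (K + 1) / (1 / 2) := by
        gcongr
        linarith
      _ = 2 * ((p : ℝ) ^ (K + 1))⁻¹ := by rw [inv_pow]; ring
      _ ≤ 2 * (√n * p)⁻¹ := by gcongr
      _ = _ := by rw [mul_inv]; ring
  refine (Finset.abs_sum_le_sum_abs _ _).trans ((Finset.sum_le_sum hterm).trans ?_)
  rw [← Finset.mul_sum]
  have hharm : ∑ p ∈ Nat.primesLE n, (p : ℝ)⁻¹ ≤ 1 + Real.log n := by
    refine le_trans ?_ (harmonic_le_one_add_log n)
    rw [harmonic_eq_sum_Icc, Nat.primesLE_eq_filter_Icc_one]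
    push_cast
    refine Finset.sum_le_sum_of_subset_of_nonneg (Finset.filter_subset _ _) fun i _ _ => ?_
    positivity
  calc _ ≤ 2 / √n * (1 + Real.log n) := by gcongr
    _ = _ := by ring

theorem tendsto_mertensLog :
    Tendsto (fun n : ℕ => (mertensLog n - Real.log (Real.log n) -
      Real.eulerMascheroniConstant) * Real.log n) atTop (𝓝 0) := by
  have h1 := tendsto_mangoldtDivLogSum.comp (tendsto_natCast_atTop_atTop (R := ℝ))
  have h2 : Tendsto (fun n : ℕ => 2 * (1 + Real.log n) / √n * Real.log n) atTop (𝓝 0) := by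
    have h3 : Tendsto (fun x : ℝ => 2 * (1 + Real.log x) / √x * Real.log x) atTop (𝓝 0) := by
      have ha := (isLittleO_log_rpow_rpow_atTop 1 (show (0 : ℝ) < 1 / 2 by norm_num)).tendsto_div_nhds_zero
      have hb := (isLittleO_log_rpow_rpow_atTop 2 (show (0 : ℝ) < 1 / 2 by norm_num)).tendsto_div_nhds_zero
      have hab := (ha.const_mul 2).add (hb.const_mul 2)
      rw [mul_zero, add_zero] at hab
      refine hab.congr fun x => ?_
      rw [Real.sqrt_eq_rpow, Real.rpow_one, Real.rpow_two]
      ring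
    exact h3.comp tendsto_natCast_atTop_atTop
  have h4 : Tendsto (fun n : ℕ => (mertensLog n - mangoldtDivLogSum n) * Real.log n)
      atTop (𝓝 0) := by
    refine squeeze_zero_norm' ?_ h2
    filter_upwards [eventually_ge_atTop 1] with n hn
    rw [norm_mul, Real.norm_of_nonneg (Real.log_natCast_nonneg n), Real.norm_eq_abs]
    have := Real.log_natCast_nonneg n
    gcongr
    exact abs_mertensLog_sub_le hn
  have h5 := h1.add h4
  rw [add_zero] at h5
  refine h5.congr fun n => ?_
  simp only [Function.comp]
  ring

/-- Mertens' third theorem with the error term of the prime number theorem: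
`∏_{p ≤ n} (1 - 1/p)⁻¹ = e^γ log n + o(1)`. -/
theorem tendsto_prod_primesLE_sub :
    Tendsto (fun n : ℕ => ∏ p ∈ Nat.primesLE n, (1 - (p : ℝ)⁻¹)⁻¹ -
      Real.exp Real.eulerMascheroniConstant * Real.log n) atTop (𝓝 0) := by
  set γ := Real.eulerMascheroniConstant with hγ
  have hprod : ∀ n : ℕ, ∏ p ∈ Nat.primesLE n, (1 - (p : ℝ)⁻¹)⁻¹ = Real.exp (mertensLog n) := by
    intro n
    rw [mertensLog, Real.exp_sum]
    refine Finset.prod_congr rfl fun p hp => ?_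
    have hp1 : (1 : ℝ) < p := by exact_mod_cast Nat.one_lt_of_mem_primesLE hp
    have : 0 < 1 - (p : ℝ)⁻¹ := sub_pos.2 (inv_lt_one_of_one_lt₀ hp1)
    rw [Real.exp_neg, Real.exp_log this]
  set η : ℕ → ℝ := fun n => mertensLog n - Real.log (Real.log n) - γ with hη
  have hη1 : Tendsto (fun n => η n * Real.log n) atTop (𝓝 0) := tendsto_mertensLog
  have hlogtop : Tendsto (fun n : ℕ => Real.log n) atTop atTop :=
    Real.tendsto_log_atTop.comp tendsto_natCast_atTop_atTop
  have hη0 : Tendsto η atTop (𝓝 0) := by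
    have h := hη1.mul (tendsto_inv_atTop_zero.comp hlogtop)
    rw [mul_zero] at h
    refine h.congr' ?_
    filter_upwards [hlogtop.eventually (eventually_gt_atTop 0)] with n hn
    simp only [Function.comp]
    field_simp
  have hb : Tendsto (fun n => Real.exp γ * (2 * |η n * Real.log n|)) atTop (𝓝 0) := by
    simpa using (hη1.abs.const_mul 2).const_mul (Real.exp γ)
  refine squeeze_zero_norm' ?_ hb
  filter_upwards [hlogtop.eventually (eventually_gt_atTop 0),
    hη0.abs.eventually (eventually_le_nhds (show |(0 : ℝ)| < 1 by simp))] with n hn hn1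
  have h1 : mertensLog n = η n + Real.log (Real.log n) + γ := by simp only [hη]; ring
  rw [hprod, h1, Real.exp_add, Real.exp_add, Real.exp_log hn,
    show Real.exp (η n) * Real.log n * Real.exp γ - Real.exp γ * Real.log n =
      Real.exp γ * ((Real.exp (η n) - 1) * Real.log n) by ring, norm_mul, norm_mul,
    Real.norm_of_nonneg (Real.exp_pos γ).le, Real.norm_of_nonneg hn.le, abs_mul,
    abs_of_pos hn, ← mul_assoc 2]
  gcongr
  exact Real.abs_exp_sub_one_le hn1

/-! ### Domination of σ(n)/n by primorials, and the lower bound for d -/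

theorem sigma_one_prime_pow_div {p : ℕ} (hp : p.Prime) (a : ℕ) :
    (sigma 1 (p ^ a) : ℝ) / ((p ^ a : ℕ) : ℝ) =
      (1 - (p : ℝ)⁻¹ ^ (a + 1)) * (1 - (p : ℝ)⁻¹)⁻¹ := by
  have hp1 : (1 : ℝ) < p := by exact_mod_cast hp.one_lt
  have hp0 : (p : ℝ) ≠ 0 := by positivity
  have hp2 : (p : ℝ) - 1 ≠ 0 := by linarith
  rw [sigma_one_apply_prime_pow hp]
  push_cast
  rw [geom_sum_eq hp1.ne', inv_pow]
  have h : 1 - (p : ℝ)⁻¹ = (p - 1) / p := by field_simp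
  rw [h]
  field_simp
  ring

theorem sigma_one_prod_prime_pow_div {S : Finset ℕ} (hS : ∀ p ∈ S, p.Prime) (e : ℕ → ℕ) :
    (sigma 1 (∏ p ∈ S, p ^ e p) : ℝ) / ((∏ p ∈ S, p ^ e p : ℕ) : ℝ) =
      ∏ p ∈ S, (1 - (p : ℝ)⁻¹ ^ (e p + 1)) * (1 - (p : ℝ)⁻¹)⁻¹ := by
  rw [isMultiplicative_sigma.map_prod (fun p => p ^ e p) S]
  · push_cast
    rw [← Finset.prod_div_distrib]
    refine Finset.prod_congr rfl fun p hp => ?_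
    rw [← sigma_one_prime_pow_div (hS p hp)]
    push_cast
    rfl
  · intro p hp q hq hpq
    exact Nat.Coprime.pow _ _ ((Nat.coprime_primes (hS p hp) (hS q hq)).2 hpq)

theorem one_sub_inv_prime_pos {p : ℕ} (hp : p.Prime) : 0 < 1 - (p : ℝ)⁻¹ :=
  sub_pos.2 (inv_lt_one_of_one_lt₀ (by exact_mod_cast hp.one_lt))

/-- Each local factor is (1 - p^(-a-1))/(1 - 1/p), and its numerator is at most 1. -/
theorem sigma_one_div_le_prod_primeFactors {n : ℕ} (hn : n ≠ 0) :
    (sigma 1 n : ℝ) / n ≤ ∏ p ∈ n.primeFactors, (1 - (p : ℝ)⁻¹)⁻¹ := by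
  have h := sigma_one_prod_prime_pow_div (S := n.primeFactors)
    (fun p hp => Nat.prime_of_mem_primeFactors hp) n.factorization
  have h2 : ∏ p ∈ n.primeFactors, p ^ n.factorization p = n :=
    Nat.prod_factorization_pow_eq_self hn
  rw [h2] at h
  rw [h]
  refine Finset.prod_le_prod (fun p hp => ?_) fun p hp => ?_
  · have h1 := one_sub_inv_prime_pos (Nat.prime_of_mem_primeFactors hp)
    have h3 : (p : ℝ)⁻¹ ^ (n.factorization p + 1) ≤ 1 := pow_le_one₀ (by positivity) (by linarith)
    exact mul_nonneg (by linarith) (inv_pos.2 h1).le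
  · have h1 := one_sub_inv_prime_pos (Nat.prime_of_mem_primeFactors hp)
    have h3 : 0 ≤ (p : ℝ)⁻¹ ^ (n.factorization p + 1) := by positivity
    exact mul_le_of_le_one_left (inv_pos.2 h1).le (by linarith)

/-- Among sets of primes of given size, an initial segment minimizes the product of a nonnegative
increasing function. -/
theorem prod_primesLE_le_prod {f : ℕ → ℝ} (hf0 : ∀ p, p.Prime → 0 < f p)
    (hf : ∀ p q, p.Prime → q.Prime → p ≤ q → f p ≤ f q) {S : Finset ℕ} (hS : ∀ p ∈ S, p.Prime)
    {q : ℕ} (hq : q.Prime) (hcard : (Nat.primesLE q).card = S.card) :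
    ∏ p ∈ Nat.primesLE q, f p ≤ ∏ p ∈ S, f p := by
  set P := Nat.primesLE q with hP
  have hPp : ∀ p ∈ P, p.Prime := fun p hp => Nat.prime_of_mem_primesLE hp
  -- Exchange argument: the two differences have equal size, with primes at most q in `P \ S` and
  -- above q in `S \ P`, so f q separates the factors.
  have hc : (P \ S).card = (S \ P).card := Finset.card_sdiff_comm hcard
  rw [← Finset.prod_inter_mul_prod_sdiff P S, ← Finset.prod_inter_mul_prod_sdiff S P,
    Finset.inter_comm S P]
  have hpos : 0 ≤ ∏ p ∈ P ∩ S, f p :=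
    Finset.prod_nonneg fun p hp => (hf0 p (hPp p (Finset.mem_inter.1 hp).1)).le
  refine mul_le_mul_of_nonneg_left ?_ hpos
  calc ∏ p ∈ P \ S, f p ≤ ∏ _p ∈ P \ S, f q := by
        refine Finset.prod_le_prod (fun p hp => ?_) fun p hp => ?_
        · exact (hf0 p (hPp p (Finset.mem_sdiff.1 hp).1)).le
        · have := (Finset.mem_sdiff.1 hp).1
          exact hf p q (hPp p this) hq (Nat.le_of_mem_primesLE this)
    _ = ∏ _p ∈ S \ P, f q := by rw [Finset.prod_const, Finset.prod_const, hc]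
    _ ≤ ∏ p ∈ S \ P, f p := by
        refine Finset.prod_le_prod (fun p hp => (hf0 q hq).le) fun p hp => ?_
        obtain ⟨h1, h2⟩ := Finset.mem_sdiff.1 hp
        refine hf q p hq (hS p h1) ?_
        by_contra h
        exact h2 (Nat.mem_primesLE.2 ⟨by omega, hS p h1⟩)

theorem exists_prime_card_primesLE_eq {k : ℕ} (hk : k ≠ 0) :
    ∃ q, q.Prime ∧ (Nat.primesLE q).card = k := by
  refine ⟨Nat.nth Nat.Prime (k - 1), Nat.prime_nth_prime _, ?_⟩
  rw [Nat.primesLE_card_eq_primeCounting, Nat.primeCounting, Nat.primeCounting',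
    Nat.count_nth_succ_of_infinite Nat.infinite_setOfPred_prime]
  omega

theorem theta_natCast (n : ℕ) : θ n = Real.log (∏ p ∈ Nat.primesLE n, (p : ℝ)) := by
  rw [theta_eq_sum_primesLE_log, Real.log_prod fun p hp => ?_]
  exact_mod_cast (Nat.prime_of_mem_primesLE hp).ne_zero

/-- Each `n ≥ 2` is dominated by a primorial. -/
theorem exists_prime_sigma_one_div_le {n : ℕ} (hn : 2 ≤ n) :
    ∃ q : ℕ, q.Prime ∧ (sigma 1 n : ℝ) / n ≤ ∏ p ∈ Nat.primesLE q, (1 - (p : ℝ)⁻¹)⁻¹ ∧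
      θ q ≤ Real.log n := by
  have hcard : n.primeFactors.card ≠ 0 := by
    rw [Finset.card_ne_zero, Nat.nonempty_primeFactors]
    omega
  -- The exchange argument is used twice with this q: for 1 - 1/p, inverted to bound σ(n)/n, and for
  -- p itself, to bound the primorial by the radical of n.
  obtain ⟨q, hq, hqc⟩ := exists_prime_card_primesLE_eq hcard
  have hS : ∀ p ∈ n.primeFactors, p.Prime := fun p hp => Nat.prime_of_mem_primeFactors hp
  refine ⟨q, hq, ?_, ?_⟩
  · refine (sigma_one_div_le_prod_primeFactors (by omega)).trans ?_
    have h := prod_primesLE_le_prod (f := fun p => 1 - (p : ℝ)⁻¹)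
      (fun p hp => one_sub_inv_prime_pos hp) (fun p r hp hr hpr => ?_) hS hq hqc
    · rw [Finset.prod_inv_distrib, Finset.prod_inv_distrib]
      refine inv_anti₀ ?_ h
      exact Finset.prod_pos fun p hp => one_sub_inv_prime_pos (Nat.prime_of_mem_primesLE hp)
    · have : (0 : ℝ) < p := by exact_mod_cast hp.pos
      gcongr
  · have h := prod_primesLE_le_prod (f := fun p => (p : ℝ))
      (fun p hp => by exact_mod_cast hp.pos) (fun p r _ _ hpr => by exact_mod_cast hpr) hS hq hqc
    rw [theta_natCast]
    refine Real.log_le_log ?_ (h.trans ?_)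
    · exact Finset.prod_pos fun p hp => by exact_mod_cast (Nat.prime_of_mem_primesLE hp).pos
    · rw [← Nat.cast_prod]
      exact_mod_cast Nat.le_of_dvd (by omega) (Nat.prod_primeFactors_dvd n)

theorem prod_primesLE_mono {m n : ℕ} (h : m ≤ n) :
    ∏ p ∈ Nat.primesLE m, (1 - (p : ℝ)⁻¹)⁻¹ ≤ ∏ p ∈ Nat.primesLE n, (1 - (p : ℝ)⁻¹)⁻¹ := by
  refine Finset.prod_le_prod_of_subset_of_one_le (Nat.primesLE_mono h) (fun p hp => ?_)
    fun p hp _ => ?_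
  · exact (inv_pos.2 (one_sub_inv_prime_pos (Nat.prime_of_mem_primesLE hp))).le
  · refine (one_le_inv₀ (one_sub_inv_prime_pos (Nat.prime_of_mem_primesLE hp))).2 ?_
    have : (0 : ℝ) ≤ (p : ℝ)⁻¹ := by positivity
    linarith

/-- `d(n)` is bounded below by `o(1)`. -/
theorem eventually_neg_le_robinDiff {ε : ℝ} (hε : 0 < ε) : ∀ᶠ n : ℕ in atTop, -ε ≤ robinDiff n := by
  set γ := Real.eulerMascheroniConstant with hγ
  set E := Real.exp γ with hE
  have hE0 : 0 < E := Real.exp_pos γ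
  set M : ℕ → ℝ := fun q => ∏ p ∈ Nat.primesLE q, (1 - (p : ℝ)⁻¹)⁻¹ with hM
  have hθ : Tendsto (fun q : ℕ => M q - E * Real.log q - E * Real.log (θ q / q)) atTop (𝓝 0) := by
    have h1 := (tendsto_theta_div_self.comp (tendsto_natCast_atTop_atTop (R := ℝ))).log one_ne_zero
    rw [Real.log_one] at h1
    have h2 := tendsto_prod_primesLE_sub.sub (h1.const_mul E)
    rwa [mul_zero, sub_zero] at h2
  obtain ⟨Q, hQ⟩ := eventually_atTop.1 (hθ.eventually (eventually_le_nhds hε))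
  have hloglog : Tendsto (fun n : ℕ => E * Real.log (Real.log n)) atTop atTop :=
    ((Real.tendsto_log_atTop.comp Real.tendsto_log_atTop).comp
      tendsto_natCast_atTop_atTop).const_mul_atTop hE0
  filter_upwards [eventually_ge_atTop 2, hloglog.eventually (eventually_ge_atTop (M Q))]
    with n hn hnQ
  obtain ⟨q, hq, h1, h2⟩ := exists_prime_sigma_one_div_le hn
  rw [robinDiff]
  -- A large n may have few prime factors, so q need not tend to infinity. For q ≤ Q the bounded
  -- quantity M(Q) is beaten by the growth of log log n.
  rcases le_total Q q with h | h
  · have h3 := hQ q h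
    have hq2 : (2 : ℝ) ≤ q := by exact_mod_cast hq.two_le
    have hθ0 : 0 < θ (q : ℝ) := theta_pos hq2
    have h4 : Real.log (θ q) ≤ Real.log (Real.log n) := Real.log_le_log hθ0 h2
    rw [Real.log_div hθ0.ne' (by linarith)] at h3
    have h5 : E * Real.log (θ q) ≤ E * Real.log (Real.log n) := by gcongr
    have h6 : E * (Real.log (θ q) - Real.log q) = E * Real.log (θ q) - E * Real.log q := by ring
    linarith
  · have h3 : M q ≤ M Q := prod_primesLE_mono h
    linarith

/-! ### A nearly extremal sequence -/

/-- The exponents of the primes in a sequence of nearly extremal integers. -/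
def robinExponent (m p : ℕ) : ℕ := if p ≤ m then m + 1 else 1

/-- A sequence of integers with `σ(n)/n` close to `e^γ log log n`. -/
def robinSeq (m : ℕ) : ℕ := ∏ p ∈ Nat.primesLE (m ^ 3), p ^ robinExponent m p

theorem robinSeq_pos (m : ℕ) : 0 < robinSeq m :=
  Finset.prod_pos fun _ hp => pow_pos (Nat.prime_of_mem_primesLE hp).pos _

/-- The m extra copies of the primes up to m add m θ(m), of order m², negligible against θ(m³) ~ m³.
-/
theorem log_robinSeq (m : ℕ) : Real.log (robinSeq m) = θ ((m : ℝ) ^ 3) + m * θ m := by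
  have h1 : θ ((m : ℝ) ^ 3) = ∑ p ∈ Nat.primesLE (m ^ 3), Real.log p := by
    rw [← theta_eq_sum_primesLE_log]
    push_cast
    rfl
  have h2 : θ m = ∑ p ∈ Nat.primesLE (m ^ 3), if p ≤ m then Real.log p else 0 := by
    rw [theta_eq_sum_primesLE_log, ← Finset.sum_filter]
    refine Finset.sum_congr ?_ fun _ _ => rfl
    ext p
    have : m ≤ m ^ 3 := Nat.le_self_pow (by norm_num) m
    simp only [Nat.mem_primesLE, Finset.mem_filter]
    constructor
    · rintro ⟨h, hp⟩
      exact ⟨⟨by omega, hp⟩, h⟩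
    · rintro ⟨⟨_, hp⟩, h⟩
      exact ⟨h, hp⟩
  rw [robinSeq, h1, h2, Finset.mul_sum, ← Finset.sum_add_distrib]
  push_cast
  rw [Real.log_prod fun p hp => pow_ne_zero _
    (by exact_mod_cast (Nat.prime_of_mem_primesLE hp).ne_zero)]
  refine Finset.sum_congr rfl fun p _ => ?_
  rw [Real.log_pow, robinExponent]
  split_ifs
  · push_cast
    ring
  · simp

theorem tendsto_log_robinSeq_div :
    Tendsto (fun m : ℕ => Real.log (robinSeq m) / (m : ℝ) ^ 3) atTop (𝓝 1) := by
  have hcast := tendsto_natCast_atTop_atTop (R := ℝ)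
  have h1 := tendsto_theta_div_self.comp ((tendsto_pow_atTop (α := ℝ) (n := 3) (by norm_num)).comp hcast)
  have h2 := (tendsto_theta_div_self.comp hcast).mul (tendsto_inv_atTop_zero.comp hcast)
  rw [mul_zero] at h2
  have h3 := h1.add h2
  rw [add_zero] at h3
  refine h3.congr' ?_
  filter_upwards [eventually_gt_atTop 0] with m hm
  have hm' : (m : ℝ) ≠ 0 := by positivity
  simp only [Function.comp]
  rw [log_robinSeq]
  field_simp

theorem sq_le_two_pow {m : ℕ} (hm : 4 ≤ m) : m ^ 2 ≤ 2 ^ m := by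
  induction m, hm using Nat.le_induction with
  | base => norm_num
  | succ k hk ih =>
    rw [pow_succ 2 k]
    nlinarith

/-- There are fewer than m primes up to m, each giving at most 2^(-m) ≤ 1/m² (hence m ≥ 4); the
larger ones give at most the tail of ∑ 1/p² over integers beyond m, below 1/m. -/
theorem sum_robinExponent_le {m : ℕ} (hm : 4 ≤ m) :
    ∑ p ∈ Nat.primesLE (m ^ 3), (p : ℝ)⁻¹ ^ (robinExponent m p + 1) ≤ 2 / m := by
  have hm0 : (0 : ℝ) < m := by positivity
  have hle : m ≤ m ^ 3 := Nat.le_self_pow (by norm_num) m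
  have hsub : Nat.primesLE (m ^ 3) ⊆ Finset.Ioc 1 m ∪ Finset.Ioc m (m ^ 3) := by
    intro p hp
    have h1 := Nat.one_lt_of_mem_primesLE hp
    have h2 := Nat.le_of_mem_primesLE hp
    simp only [Finset.mem_union, Finset.mem_Ioc]
    omega
  refine (Finset.sum_le_sum_of_subset_of_nonneg hsub fun p _ _ => by positivity).trans ?_
  rw [Finset.sum_union (Finset.disjoint_left.2 fun p h1 h2 => by
    simp only [Finset.mem_Ioc] at h1 h2
    omega)]
  have hA : ∑ p ∈ Finset.Ioc 1 m, (p : ℝ)⁻¹ ^ (robinExponent m p + 1) ≤ 1 / m := by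
    have hpow : (m : ℝ) ^ 2 ≤ 2 ^ m := by
      exact_mod_cast sq_le_two_pow hm
    have hterm : ∀ p ∈ Finset.Ioc 1 m, (p : ℝ)⁻¹ ^ (robinExponent m p + 1) ≤ ((m : ℝ) ^ 2)⁻¹ := by
      intro p hp
      obtain ⟨h1, h2⟩ := Finset.mem_Ioc.1 hp
      have hp2 : (2 : ℝ) ≤ p := by exact_mod_cast h1
      rw [robinExponent, if_pos h2, inv_pow]
      gcongr
      calc (m : ℝ) ^ 2 ≤ 2 ^ m := hpow
        _ ≤ (p : ℝ) ^ m := by gcongr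
        _ ≤ (p : ℝ) ^ (m + 1 + 1) := pow_le_pow_right₀ (by linarith) (by omega)
    refine (Finset.sum_le_card_nsmul _ _ _ hterm).trans ?_
    rw [Nat.card_Ioc, nsmul_eq_mul]
    calc ((m - 1 : ℕ) : ℝ) * ((m : ℝ) ^ 2)⁻¹ ≤ m * ((m : ℝ) ^ 2)⁻¹ := by
          gcongr
          omega
      _ = 1 / m := by field_simp
  have hB : ∑ p ∈ Finset.Ioc m (m ^ 3), (p : ℝ)⁻¹ ^ (robinExponent m p + 1) ≤ 1 / m := by
    have h := sum_Ioc_inv_sq_le_sub (α := ℝ) (show m ≠ 0 by omega) hle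
    have h2 : (0 : ℝ) ≤ ((m ^ 3 : ℕ) : ℝ)⁻¹ := by positivity
    rw [one_div]
    refine le_trans (le_of_eq ?_) (h.trans (by linarith))
    refine Finset.sum_congr rfl fun p hp => ?_
    have h1 := (Finset.mem_Ioc.1 hp).1
    rw [robinExponent, if_neg (by omega), inv_pow]
  calc _ ≤ 1 / (m : ℝ) + 1 / m := add_le_add hA hB
    _ = 2 / m := by ring

/-- Weierstrass's product inequality; it turns the sum of local losses into one factor 1 - 2/m. -/
theorem one_sub_sum_le_prod_one_sub {S : Finset ℕ} {a : ℕ → ℝ} (h0 : ∀ p ∈ S, 0 ≤ a p)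
    (h1 : ∀ p ∈ S, a p ≤ 1) : 1 - ∑ p ∈ S, a p ≤ ∏ p ∈ S, (1 - a p) := by
  induction S using Finset.induction_on with
  | empty => simp
  | insert p S hp ih =>
    have ih' := ih (fun q hq => h0 q (Finset.mem_insert_of_mem hq))
      fun q hq => h1 q (Finset.mem_insert_of_mem hq)
    have hp0 := h0 p (Finset.mem_insert_self p S)
    have hp1 := h1 p (Finset.mem_insert_self p S)
    have hs : 0 ≤ ∑ q ∈ S, a q :=
      Finset.sum_nonneg fun q hq => h0 q (Finset.mem_insert_of_mem hq)
    rw [Finset.sum_insert hp, Finset.prod_insert hp]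
    calc 1 - (a p + ∑ q ∈ S, a q) ≤ (1 - a p) * (1 - ∑ q ∈ S, a q) := by nlinarith
      _ ≤ _ := mul_le_mul_of_nonneg_left ih' (by linarith)

theorem le_sigma_one_robinSeq_div {m : ℕ} (hm : 4 ≤ m) :
    (∏ p ∈ Nat.primesLE (m ^ 3), (1 - (p : ℝ)⁻¹)⁻¹) * (1 - 2 / m) ≤
      (sigma 1 (robinSeq m) : ℝ) / robinSeq m := by
  rw [robinSeq, sigma_one_prod_prime_pow_div (fun p hp => Nat.prime_of_mem_primesLE hp),
    Finset.prod_mul_distrib, mul_comm]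
  refine mul_le_mul_of_nonneg_right ?_ ?_
  · have h := one_sub_sum_le_prod_one_sub (S := Nat.primesLE (m ^ 3))
      (a := fun p => (p : ℝ)⁻¹ ^ (robinExponent m p + 1)) (fun p _ => by positivity)
      (fun p hp => pow_le_one₀ (by positivity)
        (by linarith [one_sub_inv_prime_pos (Nat.prime_of_mem_primesLE hp)]))
    linarith [sum_robinExponent_le hm]
  · exact Finset.prod_nonneg fun p hp =>
      (inv_pos.2 (one_sub_inv_prime_pos (Nat.prime_of_mem_primesLE hp))).le

theorem tendsto_robinSeq_atTop : Tendsto robinSeq atTop atTop := by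
  have hcast := tendsto_natCast_atTop_atTop (R := ℝ)
  have h1 : Tendsto (fun m : ℕ => Real.log (robinSeq m)) atTop atTop := by
    have h := tendsto_log_robinSeq_div.pos_mul_atTop one_pos
      ((tendsto_pow_atTop (α := ℝ) (n := 3) (by norm_num)).comp hcast)
    refine h.congr' ?_
    filter_upwards [eventually_gt_atTop 0] with m hm
    have hm' : (m : ℝ) ≠ 0 := by positivity
    simp only [Function.comp]
    field_simp
  have h2 := Real.tendsto_exp_atTop.comp h1
  refine (tendsto_natCast_atTop_iff (R := ℝ)).1 (h2.congr fun m => ?_)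
  exact Real.exp_log (by exact_mod_cast robinSeq_pos m)

/-- `d(n)` is at most `o(1)` along a sequence. -/
theorem frequently_robinDiff_le {ε : ℝ} (hε : 0 < ε) : ∃ᶠ n : ℕ in atTop, robinDiff n ≤ ε := by
  set E := Real.exp Real.eulerMascheroniConstant with hE
  set M : ℕ → ℝ := fun q => ∏ p ∈ Nat.primesLE q, (1 - (p : ℝ)⁻¹)⁻¹ with hM
  have hcast := tendsto_natCast_atTop_atTop (R := ℝ)
  have hpow : Tendsto (fun m : ℕ => m ^ 3) atTop atTop := tendsto_pow_atTop (by norm_num)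
  have h1 : Tendsto (fun m : ℕ => M (m ^ 3) - E * Real.log (m ^ 3 : ℕ)) atTop (𝓝 0) :=
    tendsto_prod_primesLE_sub.comp hpow
  have h2 : Tendsto (fun m : ℕ => E * Real.log (Real.log (robinSeq m) / (m : ℝ) ^ 3))
      atTop (𝓝 0) := by
    simpa using (tendsto_log_robinSeq_div.log one_ne_zero).const_mul E
  have h3 : Tendsto (fun m : ℕ => M (m ^ 3) * (2 / m)) atTop (𝓝 0) := by
    have ha : Tendsto (fun m : ℕ => (2 : ℝ) / m) atTop (𝓝 0) := tendsto_const_div_atTop_nhds_zero_nat 2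
    have hb : Tendsto (fun m : ℕ => Real.log (m : ℝ) / m) atTop (𝓝 0) :=
      Real.isLittleO_log_id_atTop.tendsto_div_nhds_zero.comp hcast
    -- Since log(m³) = 3 log m, the main term e^γ log(m³) times 2/m equals 6 e^γ (log m)/m.
    have h := (h1.mul ha).add (hb.const_mul (6 * E))
    rw [mul_zero, mul_zero, add_zero] at h
    refine h.congr fun m => ?_
    push_cast
    rw [Real.log_pow]
    push_cast
    ring
  have hbound := (h2.sub h1).add h3
  rw [sub_zero, add_zero] at hbound
  refine tendsto_robinSeq_atTop.frequently (Eventually.frequently ?_)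
  filter_upwards [hbound.eventually (eventually_le_nhds hε), eventually_ge_atTop 4,
    tendsto_log_robinSeq_div.eventually (lt_mem_nhds one_pos)] with m hm hm4 hmpos
  have h4 := le_sigma_one_robinSeq_div hm4
  have hm0 : (0 : ℝ) < (m : ℝ) ^ 3 := by positivity
  have h5 : Real.log (Real.log (robinSeq m)) = Real.log (Real.log (robinSeq m) / (m : ℝ) ^ 3) +
      Real.log ((m ^ 3 : ℕ) : ℝ) := by
    push_cast
    rw [← Real.log_mul hmpos.ne' hm0.ne', div_mul_cancel₀ _ hm0.ne']
  rw [robinDiff, h5, mul_add]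
  have h6 : M (m ^ 3) * (1 - 2 / m) = M (m ^ 3) - M (m ^ 3) * (2 / m) := by ring
  change M (m ^ 3) * (1 - 2 / m) ≤ _ at h4
  linarith

/-! ### The limit inferior -/

theorem theorem1 :
    Filter.liminf (fun n : ℕ => ((robinDiff n : ℝ) : EReal)) Filter.atTop = 0 := by
  refine le_antisymm ?_ ?_
  · refine EReal.le_of_forall_lt_iff_le.1 fun ε hε => ?_
    refine liminf_le_of_frequently_le' ?_
    refine (frequently_robinDiff_le (by exact_mod_cast hε)).mono fun n hn => ?_
    exact_mod_cast hn
  · refine EReal.ge_of_forall_gt_iff_ge.1 fun ε hε => ?_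
    have hε' : 0 < -ε := by
      have : ε < 0 := by exact_mod_cast hε
      linarith
    refine le_liminf_of_le (by isBoundedDefault) ?_
    filter_upwards [eventually_neg_le_robinDiff hε'] with n hn
    rw [neg_neg] at hn
    exact_mod_cast hn
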